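/- Write $[n]=\{1,\dots,n\}$. A rooted labeled forest on $[n]$ is a forest with vertex set $[n]$ (each vertex is its own label) in which every connected component has a distinguished root; children are unordered. A consecutive instance of a permutation $\pi=\pi(1)\cdots\pi(k)$ in such a forest is a sequence of vertices $v_1,\dots,v_k$, each $v_i$ ($1\le i<k$) being the parent of $v_{i+1}$, whose labels are in the same relative order as $\pi(1)\cdots\pi(k)$. Two permutations $\pi,\pi'$ are strongly c-forest-Wilf equivalent if for all $m,n\ge 0$ the number of rooted labeled forests on $[n]$ with exactly $m$ consecutive instances of $\pi$ equals the number with exactly $m$ consecutive instances of $\pi'$. The streak of $\pi$ is the largest integer $m$ with $\pi(i)=i$ for all $1\le i\le m$. A permutation $\pi$ of $[k]$ is grounded if it is not the identity and there is a positive integer $m$ such that $\pi(1)\cdots\pi(m)=1\cdots m$ and there is no run of $m+1$ consecutive entries of $\pi(2)\cdots\pi(k)$ that is increasing. Let $\pi$ and $\pi'$ be grounded permutations of $[k]$ that are strongly c-forest-Wilf equivalent, and let $s$ be the streak of $\pi$. Then $s<k$, and $\pi(s+1)=\pi'(s+1)$ or $\pi(s+1)+\pi'(s+1)=s+k+1$.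 Furthermore, if $d$ is the least positive integer such that $\{\pi(d),\dots,\pi(k)\}$ does not contain two consecutive numbers (two integers $x$, $x+1$), and $d'$ is the least positive integer such that $\{\pi'(d'),\dots,\pi'(k)\}$ does not contain two consecutive numbers, then $d=d'$. -/

import Mathlib

namespace ForestWilf

/-- A rooted labeled forest on `[n]` (the label set `{1, …, n}` is modelled by `Fin n`, and a vertex
is identified with its label): `parent v` is `none` if `v` is the root of its component and `some u`
if `u` is the parent of `v`; following parents never leads back to the starting vertex. -/
@[ext]
structure RootedForest (n : ℕ) where
  parent : Fin n → Option (Fin n)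
  acyclic : ∀ v, ¬ Relation.TransGen (fun u w => parent w = some u) v v

instance instFiniteRootedForest (n : ℕ) : Finite (RootedForest n) :=
  Finite.of_injective RootedForest.parent fun _ _ h => RootedForest.ext h

/-- Two sequences of the same length have the same relative order. -/
def SameOrder {k : ℕ} {α β : Type*} [LT α] [LT β] (a : Fin k → α) (b : Fin k → β) : Prop :=
  ∀ i j : Fin k, a i < a j ↔ b i < b j

/-- The vertices `v_1, …, v_k` form a consecutive instance of the pattern `π` in `F`: each is the
parent of the next one, and their labels are in the same relative order as `π(1) ⋯ π(k)`. -/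
def IsConsecInstance {n k : ℕ} (F : RootedForest n) (π : Equiv.Perm (Fin k))
    (v : Fin k → Fin n) : Prop :=
  (∀ (i : ℕ) (h : i + 1 < k), F.parent (v ⟨i + 1, h⟩) = some (v ⟨i, Nat.lt_of_succ_lt h⟩)) ∧
    SameOrder v π

/-- The number of consecutive instances of `π` in `F`. -/
noncomputable def numInstances {n k : ℕ} (F : RootedForest n) (π : Equiv.Perm (Fin k)) : ℕ :=
  Nat.card {v : Fin k → Fin n // IsConsecInstance F π v}

/-- Strong c-forest-Wilf equivalence: for all `m, n`, equally many forests on `[n]` have exactly `m`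
consecutive instances of `π` and of `π'`. -/
def StronglyEquiv {k k' : ℕ} (π : Equiv.Perm (Fin k)) (π' : Equiv.Perm (Fin k')) : Prop :=
  ∀ m n : ℕ, Nat.card {F : RootedForest n // numInstances F π = m} =
    Nat.card {F : RootedForest n // numInstances F π' = m}

/-- `π(1) ⋯ π(m) = 1 ⋯ m`. -/
def StartsWithIdentity {k : ℕ} (π : Equiv.Perm (Fin k)) (m : ℕ) : Prop :=
  m ≤ k ∧ ∀ i : Fin k, (i : ℕ) < m → π i = i

/-- `s` is the streak of `π`: the largest `m` with `π(i) = i` for all `1 ≤ i ≤ m`. -/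
def IsStreak {k : ℕ} (π : Equiv.Perm (Fin k)) (s : ℕ) : Prop :=
  IsGreatest {m : ℕ | StartsWithIdentity π m} s

/-- The sequence `π(2) ⋯ π(k)` consecutively contains the pattern `1 ⋯ r`
(`j` is the 0-based starting index, so `1 ≤ j` excludes the first entry of `π`). -/
def TailConsecContainsIdentity {k : ℕ} (π : Equiv.Perm (Fin k)) (r : ℕ) : Prop :=
  ∃ (j : ℕ) (_ : 1 ≤ j) (h : j + r ≤ k),
    SameOrder (fun i : Fin r => π ⟨j + i, lt_of_lt_of_le (Nat.add_lt_add_left i.isLt j) h⟩)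
      (Equiv.refl (Fin r))

/-- Grounded permutations: `π` is not the identity, and for some `m ≥ 1`, `π(1) ⋯ π(m) = 1 ⋯ m` and
`π(2) ⋯ π(k)` consecutively avoids `1 ⋯ (m + 1)`. -/
def IsGrounded {k : ℕ} (π : Equiv.Perm (Fin k)) : Prop :=
  π ≠ 1 ∧ ∃ m : ℕ, 0 < m ∧ StartsWithIdentity π m ∧ ¬ TailConsecContainsIdentity π (m + 1)

/-- The set `{π(d), …, π(k)}` (1-based positions) contains two consecutive numbers `x`, `x + 1`. -/
def SuffixHasConsecutive {k : ℕ} (π : Equiv.Perm (Fin k)) (d : ℕ) : Prop :=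
  ∃ i j : Fin k, d ≤ (i : ℕ) + 1 ∧ d ≤ (j : ℕ) + 1 ∧ (π j : ℕ) = (π i : ℕ) + 1

/-- `d` is the least positive integer such that `{π(d), …, π(k)}` does not contain two consecutive
numbers. -/
def IsSeparationIndex {k : ℕ} (π : Equiv.Perm (Fin k)) (d : ℕ) : Prop :=
  IsLeast {e : ℕ | 0 < e ∧ ¬ SuffixHasConsecutive π e} d

end ForestWilf

/-! Strong equivalence preserves the distribution of the number of instances, and only its second
moment is needed: the number of ordered pairs of instances, summed over all forests on `[n]`. Such a
pair is a pair of increasing label sequences together with a forest in which both are paths, and the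
number of these forests depends only on how the two sequences coincide.

Let `s` be the streak. On fewer than `2k - s` labels, two instances in one forest share more than
`s` vertices. A grounded permutation has its minimum first, and `π(2) ⋯ π(k)` has no increasing run
of length `s + 1`; hence one instance cannot start strictly inside the other, and the two share
exactly a common initial segment (`exists_branching`). With `n = 2k - j` labels, segments shorter
than `j` do not fit, and longer ones contribute equally by downward induction. So for every `j`
above both streaks, `π` and `π'` have equally many pairs of increasing sequences glued along the
values of their first `j` entries (`IsGrounded.card_balancedSets_eq`). This number depends only on
the set `K` of the remaining values; `card_gluedPairs` turns it into a count of balanced sets.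

Three evaluations finish the proof. The count is at most the central binomial coefficient of `|K|`,
attained when `K` is a final interval; together with the offset pairs that appear at `n = 2k - s`,
this forces equal streaks (`IsGrounded.streak_le`). For a final interval with one point removed it
is a product of two central binomial coefficients, which by strict log-convexity determines the
point up to reflection; this gives the claim on `π(s+1)`. Finally it equals `2 ^ |K|` exactly when
`K` has no two consecutive elements, which gives `d = d'`. -/

namespace ForestWilf

/-! ### Instances and their second moment -/

/-- Each vertex of the sequence is the parent of the next one. -/
def IsPath {n k : ℕ} (F : RootedForest n) (v : Fin k → Fin n) : Prop :=
  ∀ (i : ℕ) (h : i + 1 < k), F.parent (v ⟨i + 1, h⟩) = some (v ⟨i, Nat.lt_of_succ_lt h⟩)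

theorem sameOrder_iff_strictMono {n k : ℕ} {π : Equiv.Perm (Fin k)} {v : Fin k → Fin n} :
    SameOrder v π ↔ StrictMono (v ∘ π.symm) := by
  constructor
  · intro h x y hxy
    exact (h _ _).2 (by simpa using hxy)
  · intro h i j
    have := h.lt_iff_lt (a := π i) (b := π j)
    simpa using this

/-- Instances of `π` in `F`, described by the increasing enumeration of their labels. -/
abbrev Instances {n k : ℕ} (F : RootedForest n) (π : Equiv.Perm (Fin k)) : Type :=
  {a : Fin k ↪o Fin n // IsPath F (a ∘ π)}

theorem numInstances_eq_card {n k : ℕ} (F : RootedForest n) (π : Equiv.Perm (Fin k)) :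
    numInstances F π = Nat.card (Instances F π) := by
  refine Nat.card_congr
    { toFun := fun v => ⟨OrderEmbedding.ofStrictMono (v.1 ∘ π.symm)
        (sameOrder_iff_strictMono.1 v.2.2), ?_⟩
      invFun := fun a => ⟨a.1 ∘ π, a.2, sameOrder_iff_strictMono.2 ?_⟩
      left_inv := ?_
      right_inv := ?_ }
  · intro i h
    simpa using v.2.1 i h
  · intro x y hxy
    simpa using hxy
  · intro v
    ext x
    simp
  · intro a
    ext x
    simp

/-- The number of ordered pairs of instances of `π`, summed over all forests on `[n]`. -/
noncomputable def secondMoment {k : ℕ} (π : Equiv.Perm (Fin k)) (n : ℕ) : ℕ :=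
  Nat.card (Σ F : RootedForest n, Instances F π × Instances F π)

/-- Bijections between the fibres of the two statistics assemble into one bijection of forests, so
every quantity computed from the instance count transfers. -/
theorem StronglyEquiv.exists_equiv {k k' : ℕ} {π : Equiv.Perm (Fin k)} {π' : Equiv.Perm (Fin k')}
    (h : StronglyEquiv π π') (n : ℕ) :
    ∃ φ : RootedForest n ≃ RootedForest n, ∀ F, numInstances (φ F) π' = numInstances F π := by
  have e : ∀ m, Nonempty ({F : RootedForest n // numInstances F π = m} ≃
      {F : RootedForest n // numInstances F π' = m}) := fun m => Finite.card_eq.1 (h m n)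
  replace e := fun m => (e m).some
  refine ⟨(Equiv.sigmaFiberEquiv fun F : RootedForest n => numInstances F π).symm.trans
    ((Equiv.sigmaCongrRight e).trans
      (Equiv.sigmaFiberEquiv fun F : RootedForest n => numInstances F π')), fun F => ?_⟩
  exact (e _ ⟨F, rfl⟩).2

theorem StronglyEquiv.secondMoment_eq {k k' : ℕ} {π : Equiv.Perm (Fin k)}
    {π' : Equiv.Perm (Fin k')} (h : StronglyEquiv π π') (n : ℕ) :
    secondMoment π n = secondMoment π' n := by
  obtain ⟨φ, hφ⟩ := h.exists_equiv n
  have e : ∀ F, Nonempty (Instances F π ≃ Instances (φ F) π') := fun F => by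
    refine Finite.card_eq.1 ?_
    rw [← numInstances_eq_card, ← numInstances_eq_card, hφ]
  replace e := fun m => (e m).some
  exact Nat.card_congr (Equiv.sigmaCongr φ fun F => Equiv.prodCongr (e F) (e F))

/-! ### Forests containing two given paths -/

/-- The number of forests in which both sequences are paths. -/
noncomputable def pathCount {n k : ℕ} (v w : Fin k → Fin n) : ℕ :=
  Nat.card {F : RootedForest n // IsPath F v ∧ IsPath F w}

theorem pathCount_pos_iff {n k : ℕ} {v w : Fin k → Fin n} :
    0 < pathCount v w ↔ ∃ F : RootedForest n, IsPath F v ∧ IsPath F w := by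
  rw [pathCount, Nat.card_pos_iff]
  simp only [nonempty_subtype, and_iff_left_iff_imp]
  intro _
  infer_instance

theorem secondMoment_eq_sum {k : ℕ} (π : Equiv.Perm (Fin k)) (n : ℕ) :
    secondMoment π n =
      ∑ p : (Fin k ↪o Fin n) × (Fin k ↪o Fin n), pathCount (p.1 ∘ π) (p.2 ∘ π) := by
  simp only [pathCount]
  rw [← Nat.card_sigma]
  exact Nat.card_congr
    { toFun := fun x => ⟨(x.2.1.1, x.2.2.1), x.1, x.2.1.2, x.2.2.2⟩
      invFun := fun x => ⟨x.2.1, ⟨x.1.1, x.2.2.1⟩, ⟨x.1.2, x.2.2.2⟩⟩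
      left_inv := fun _ => rfl
      right_inv := fun _ => rfl }

/-- Relabelling the vertices of a forest. -/
def RootedForest.relabel {n : ℕ} (σ : Equiv.Perm (Fin n)) (F : RootedForest n) :
    RootedForest n where
  parent v := (F.parent (σ.symm v)).map σ
  acyclic v h := by
    refine F.acyclic (σ.symm v) (Relation.TransGen.lift (p := fun u w => F.parent w = some u) σ.symm ?_ _ _ h)
    intro a b hab
    obtain ⟨c, hc, rfl⟩ := Option.map_eq_some_iff.1 hab
    simpa [Function.onFun] using hc

theorem IsPath.relabel {n k : ℕ} {F : RootedForest n} {v : Fin k → Fin n} (h : IsPath F v)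
    (σ : Equiv.Perm (Fin n)) : IsPath (F.relabel σ) (σ ∘ v) := by
  intro i hi
  simp [RootedForest.relabel, h i hi]

theorem RootedForest.relabel_injective {n : ℕ} (σ : Equiv.Perm (Fin n)) :
    Function.Injective (RootedForest.relabel σ) := by
  intro F G h
  ext1
  funext v
  have := congrFun (congrArg RootedForest.parent h) (σ v)
  simpa [RootedForest.relabel, (Option.map_injective σ.injective).eq_iff] using this

theorem pathCount_le_relabel {n k : ℕ} (σ : Equiv.Perm (Fin n)) (v w : Fin k → Fin n) :
    pathCount v w ≤ pathCount (σ ∘ v) (σ ∘ w) :=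
  Nat.card_le_card_of_injective
    (fun F : {F : RootedForest n // IsPath F v ∧ IsPath F w} =>
      (⟨F.1.relabel σ, F.2.1.relabel σ, F.2.2.relabel σ⟩ :
        {F : RootedForest n // IsPath F (σ ∘ v) ∧ IsPath F (σ ∘ w)}))
    fun _ _ h => Subtype.ext (RootedForest.relabel_injective σ (congrArg Subtype.val h))

/-- Equal coincidences give a bijection between the two ranges, which extends to the finite ambient
type. -/
theorem exists_perm_comp_eq {α β : Type*} [Finite β] (f g : α → β)
    (h : ∀ x y, f x = f y ↔ g x = g y) : ∃ σ : Equiv.Perm β, σ ∘ f = g := by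
  classical
  let F : Set.range f → Set.range g := fun y => ⟨g y.2.choose, Set.mem_range_self _⟩
  have hF : ∀ x, F ⟨f x, x, rfl⟩ = ⟨g x, x, rfl⟩ := fun x => by
    refine Subtype.ext ((h _ _).1 ?_)
    exact (⟨x, rfl⟩ : ∃ z, f z = f x).choose_spec
  have hb : Function.Bijective F := by
    constructor
    · rintro ⟨_, x, rfl⟩ ⟨_, y, rfl⟩ hxy
      rw [hF, hF] at hxy
      exact Subtype.ext ((h _ _).2 (congrArg Subtype.val hxy))
    · rintro ⟨_, x, rfl⟩
      exact ⟨_, hF x⟩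
  let e : {y // y ∈ Set.range f} ≃ {y // y ∈ Set.range g} := Equiv.ofBijective F hb
  refine ⟨e.extendSubtype, funext fun x => ?_⟩
  rw [Function.comp_apply, Equiv.extendSubtype_apply_of_mem e _ ⟨x, rfl⟩]
  exact congrArg Subtype.val (hF x)

/-- `v` and `w` coincide exactly on their first `j` entries and are disjoint otherwise. -/
def Branching {α : Type*} {k : ℕ} (v w : Fin k → α) (j : ℕ) : Prop :=
  ∀ x y, v x = w y ↔ x = y ∧ (x : ℕ) < j

/-- Being a path ignores the order of the labels, so a relabelling, not necessarily monotone,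
carries one pair to any other of the same shape. Exchanging the pairs gives the reverse inequality.
-/
theorem Branching.pathCount_le {n k j : ℕ} {v w v' w' : Fin k → Fin n}
    (hv : Function.Injective v) (hw : Function.Injective w)
    (hv' : Function.Injective v') (hw' : Function.Injective w')
    (h : Branching v w j) (h' : Branching v' w' j) : pathCount v w ≤ pathCount v' w' := by
  obtain ⟨σ, hσ⟩ := exists_perm_comp_eq (Sum.elim v w) (Sum.elim v' w') (by
    rintro (x | x) (y | y)
    · simp [hv.eq_iff, hv'.eq_iff]
    · exact (h x y).trans (h' x y).symm
    · exact eq_comm.trans (((h y x).trans (h' y x).symm).trans eq_comm)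
    · simp [hw.eq_iff, hw'.eq_iff])
  have e1 : σ ∘ v = v' := funext fun x => congrFun hσ (Sum.inl x)
  have e2 : σ ∘ w = w' := funext fun x => congrFun hσ (Sum.inr x)
  simpa [e1, e2] using pathCount_le_relabel σ v w

/-- The forest on `[n]` consisting of two chains: `0, …, k - 1`, and `k, …, n - 1` whose top is a
child of `p`. -/
def forkForest (n k p : ℕ) (hp : p < k) : RootedForest n where
  parent y := if (y : ℕ) = 0 then none else
    -- Here `y = k > p`, so the minimum is `p`; it only supplies the bound `p < n`.
    if (y : ℕ) = k then some ⟨min p y, by omega⟩ else some ⟨y - 1, by omega⟩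
  acyclic v h := by
    have key : ∀ a b : Fin n, Relation.TransGen (fun u w : Fin n =>
        (if (w : ℕ) = 0 then none else
          if (w : ℕ) = k then some (⟨min p w, by omega⟩ : Fin n) else some ⟨w - 1, by omega⟩)
            = some u) a b → (a : ℕ) < b := by
      have step : ∀ a b : Fin n, (if (b : ℕ) = 0 then none else
          if (b : ℕ) = k then some (⟨min p b, by omega⟩ : Fin n) else some ⟨b - 1, by omega⟩)
            = some a → (a : ℕ) < b := by
        intro a b hab
        split_ifs at hab with h1 h2
        · simp only [Option.some.injEq] at hab
          rw [← hab]
          simp only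
          omega
        · simp only [Option.some.injEq] at hab
          rw [← hab]
          simp only
          omega
      intro a b hab
      induction hab with
      | single h => exact step _ _ h
      | tail _ h ih => exact ih.trans (step _ _ h)
    exact lt_irrefl _ (key v v h)

/-- A sequence follows `forkForest` if it runs along `0, …, p` and then either continues on the
first chain or jumps to the second one. -/
theorem isPath_forkForest {n k p l : ℕ} (hp : p < k) {v : Fin l → Fin n}
    (h : ∀ (i : ℕ) (hi : i + 1 < l),
      (v ⟨i + 1, hi⟩ : ℕ) = k ∧ (v ⟨i, by omega⟩ : ℕ) = p ∨
        (v ⟨i + 1, hi⟩ : ℕ) ≠ k ∧ (v ⟨i + 1, hi⟩ : ℕ) = (v ⟨i, by omega⟩ : ℕ) + 1) :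
    IsPath (forkForest n k p hp) v := by
  intro i hi
  rcases h i hi with ⟨h1, h2⟩ | ⟨h1, h2⟩
  · simp only [forkForest, h1]
    rw [if_neg (by omega)]
    simp only [if_true, Option.some.injEq, Fin.ext_iff, h2]
    omega
  · simp only [forkForest]
    rw [if_neg (by omega), if_neg h1]
    simp only [Option.some.injEq, Fin.ext_iff]
    omega

/-- All branching pairs of sequences of the same shape are paths in equally many forests. -/
theorem exists_pathCount_eq {n k j : ℕ} (hj : 1 ≤ j) (hjk : j ≤ k) (hn : 2 * k - j ≤ n) :
    ∃ c, 0 < c ∧ ∀ v w : Fin k → Fin n, Function.Injective v → Function.Injective w →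
      Branching v w j → pathCount v w = c := by
  let v₀ : Fin k → Fin n := fun x => ⟨x, by omega⟩
  let w₀ : Fin k → Fin n := fun x => ⟨if (x : ℕ) < j then x else k + (x - j), by split_ifs <;> omega⟩
  have hv₀ : Function.Injective v₀ := fun x y h => by
    simpa [v₀, Fin.ext_iff] using h
  have hw₀ : Function.Injective w₀ := fun x y h => by
    simp only [w₀, Fin.ext_iff] at h ⊢
    split_ifs at h <;> omega
  have hb : Branching v₀ w₀ j := fun x y => by
    simp only [v₀, w₀, Fin.ext_iff]
    split_ifs <;> omega
  -- The last shared vertex is `j - 1`, so the second chain hangs from it; this is where `1 ≤ j`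
  -- matters.
  refine ⟨pathCount v₀ w₀, pathCount_pos_iff.2 ⟨forkForest n k (j - 1) (by omega),
    isPath_forkForest _ ?_, isPath_forkForest _ ?_⟩, fun v w hv hw h =>
    le_antisymm (h.pathCount_le hv hw hv₀ hw₀ hb) (hb.pathCount_le hv₀ hw₀ hv hw h)⟩
  · intro i hi
    exact Or.inr ⟨hi.ne, rfl⟩
  · intro i hi
    simp only [w₀]
    split_ifs <;> omega


/-! ### How two instances in one forest overlap -/

/-- Parents are unique, so a coincidence of two paths propagates upwards. -/
theorem IsPath.eq_of_eq {n k : ℕ} {F : RootedForest n} {v w : Fin k → Fin n} (hv : IsPath F v)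
    (hw : IsPath F w) {x y : ℕ} {hx : x < k} {hy : y < k} (h : v ⟨x, hx⟩ = w ⟨y, hy⟩) (d : ℕ)
    (hdx : d ≤ x) (hdy : d ≤ y) : v ⟨x - d, by omega⟩ = w ⟨y - d, by omega⟩ := by
  induction d with
  | zero => simpa using h
  | succ d ih =>
    have h0 := ih (by omega) (by omega)
    have h1 := hv (x - (d + 1)) (by omega)
    have h2 := hw (y - (d + 1)) (by omega)
    have e1 : x - (d + 1) + 1 = x - d := by omega
    have e2 : y - (d + 1) + 1 = y - d := by omega
    simp only [e1] at h1
    simp only [e2] at h2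
    rw [h0, h2] at h1
    exact (Option.some_injective _ h1).symm

/-- Inclusion–exclusion: few labels force a long overlap. -/
theorem two_mul_le_of_overlap {n k j : ℕ} {v w : Fin k → Fin n} (hv : Function.Injective v)
    (hw : Function.Injective w) (h : ∀ x y, v x = w y → (y : ℕ) < j) : 2 * k ≤ n + j := by
  classical
  have h1 := Finset.card_union_add_card_inter (Finset.univ.image v) (Finset.univ.image w)
  rw [Finset.card_image_of_injective _ hv, Finset.card_image_of_injective _ hw] at h1
  have h2 := Finset.card_le_univ (Finset.univ.image v ∪ Finset.univ.image w)
  have h3 : (Finset.univ.image v ∩ Finset.univ.image w).card ≤ j := by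
    have : Finset.univ.image v ∩ Finset.univ.image w ⊆
        (Finset.univ.filter fun y : Fin k => (y : ℕ) < j).image w := by
      intro z hz
      simp only [Finset.mem_inter, Finset.mem_image, Finset.mem_univ, true_and] at hz
      obtain ⟨⟨x, rfl⟩, y, hy⟩ := hz
      exact Finset.mem_image.2 ⟨y, by simpa using h x y hy.symm, hy⟩
    refine (Finset.card_le_card this).trans (Finset.card_image_le.trans ?_)
    have h4 : (Finset.univ.filter fun y : Fin k => (y : ℕ) < j).map Fin.valEmbedding ⊆
        Finset.range j := by
      intro z hz
      simp only [Finset.mem_map, Finset.mem_filter, Finset.mem_univ, true_and] at hz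
      obtain ⟨y, hy, rfl⟩ := hz
      simpa using hy
    simpa using Finset.card_le_card h4
  simp only [Finset.card_univ, Fintype.card_fin] at h1 h2
  omega

/-- Climbing from a common vertex to the top of `w` fixes the shift at `i`, and common vertices are
closed under going up, so they form an initial segment of `w`. -/
theorem IsPath.exists_overlap {n k : ℕ} {F : RootedForest n} {v w : Fin k → Fin n}
    (hv : IsPath F v) (hw : IsPath F w) (hvi : Function.Injective v) {i : ℕ} (hi : i < k)
    (h : v ⟨i, hi⟩ = w ⟨0, by omega⟩) (hle : ∀ x y, v x = w y → (y : ℕ) ≤ x) :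
    ∃ j, j ≤ k ∧ ∀ x y, v x = w y ↔ (x : ℕ) = y + i ∧ (y : ℕ) < j := by
  classical
  have hex : ∃ j, ∀ hj : j < k, ¬ ∃ x, v x = w ⟨j, hj⟩ := ⟨k, fun h => absurd h (lt_irrefl _)⟩
  have hshift : ∀ x y, v x = w y → (x : ℕ) = y + i := by
    intro x y hxy
    have h1 := hv.eq_of_eq hw hxy y (hle x y hxy) le_rfl
    simp only [Nat.sub_self] at h1
    rw [← h] at h1
    have h2 := congrArg Fin.val (hvi h1)
    have := hle x y hxy
    simp only at h2
    omega
  -- The first index at which `w` is off `v`, with `k` as the value when there is none.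
  obtain ⟨j, hspec, hmin⟩ : ∃ j, (∀ hj : j < k, ¬ ∃ x, v x = w ⟨j, hj⟩) ∧
      ∀ m < j, ¬ ∀ hj : m < k, ¬ ∃ x, v x = w ⟨m, hj⟩ :=
    ⟨Nat.find hex, Nat.find_spec hex, fun m => Nat.find_min hex⟩
  have hjk : j ≤ k := by
    by_contra hlt
    push Not at hlt
    exact hmin k hlt fun h => absurd h (lt_irrefl _)
  refine ⟨j, hjk, fun x y =>
    ⟨fun hxy => ⟨hshift x y hxy, ?_⟩, ?_⟩⟩
  · by_contra hlt
    push Not at hlt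
    refine hspec (by omega) ⟨⟨x - (y - j), by omega⟩, ?_⟩
    have h1 := hv.eq_of_eq hw hxy (y - j) (by have := hle x y hxy; omega) (by omega)
    rw [h1]
    congr 2
    omega
  · rintro ⟨hxy, hy⟩
    have := hmin y hy
    push Not at this
    obtain ⟨_, x', hx'⟩ := this
    have : x = x' := by
      have := hshift _ _ hx'
      ext
      simp only at this
      omega
    rw [this, hx']

theorem StartsWithIdentity.le_apply {k s : ℕ} {π : Equiv.Perm (Fin k)}
    (h : StartsWithIdentity π s) {x : Fin k} (hx : s ≤ x) : s ≤ (π x : ℕ) := by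
  by_contra hlt
  push Not at hlt
  have := π.injective (h.2 (π x) hlt)
  rw [this] at hlt
  omega

/-- The 0-based position `s` is allowed: its value is at least `s`. Hence the first `s + 1` entries
increase, one more than the fixed ones. -/
theorem StartsWithIdentity.apply_lt_apply {k s : ℕ} {π : Equiv.Perm (Fin k)}
    (h : StartsWithIdentity π s) {x y : Fin k} (hxy : x < y) (hy : (y : ℕ) ≤ s) : π x < π y := by
  have hx : (x : ℕ) < s := lt_of_lt_of_le hxy hy
  rw [h.2 x hx]
  rcases hy.lt_or_eq with hy | hy
  · rwa [h.2 y hy]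
  · exact Fin.lt_def.2 (hx.trans_le (h.le_apply hy.ge))

/-- The streak can serve as the witness `m`: it is at least any witness, and avoiding a shorter
increasing run implies avoiding a longer one. -/
theorem IsGrounded.streak {k s : ℕ} {π : Equiv.Perm (Fin k)} (h : IsGrounded π)
    (hs : IsStreak π s) : 1 ≤ s ∧ s < k ∧ ¬ TailConsecContainsIdentity π (s + 1) := by
  obtain ⟨hne, m, hm, hst, htail⟩ := h
  have hms : m ≤ s := hs.2 hst
  refine ⟨hm.trans_le hms, ?_, ?_⟩
  · refine lt_of_le_of_ne hs.1.1 fun hsk => hne ?_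
    ext x
    rw [hs.1.2 x (by omega)]
    simp
  · rintro ⟨j, hj, hjr, hso⟩
    refine htail ⟨j, hj, by omega, fun x y => ?_⟩
    exact hso ⟨x, by omega⟩ ⟨y, by omega⟩

theorem Branching.symm {α : Type*} {k j : ℕ} {v w : Fin k → α} (h : Branching v w j) :
    Branching w v j := fun x y => by
  rw [eq_comm, h y x, eq_comm]
  exact ⟨fun h => ⟨h.1, h.1 ▸ h.2⟩, fun h => ⟨h.1, h.1 ▸ h.2⟩⟩

/-- If the second instance started at a later vertex of the first (`i > 0`), the overlap of more
than `s` vertices would copy the increasing start of `π` into `π(2) ⋯ π(k)`. -/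
theorem exists_branching_of_apply_eq {n k s i : ℕ} {F : RootedForest n} {π : Equiv.Perm (Fin k)}
    (hs : 1 ≤ s) (hst : StartsWithIdentity π s) (htail : ¬ TailConsecContainsIdentity π (s + 1))
    (hn : n + s < 2 * k) {a b : Fin k ↪o Fin n} (ha : IsPath F (a ∘ π)) (hb : IsPath F (b ∘ π))
    (hi : i < k) (h : a (π ⟨i, hi⟩) = b (π ⟨0, by omega⟩)) :
    ∃ j ≤ k, Branching (a ∘ π) (b ∘ π) j := by
  have hai : Function.Injective (a ∘ π) := a.injective.comp π.injective
  have hbi : Function.Injective (b ∘ π) := b.injective.comp π.injective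
  have hmin : ∀ (c : Fin k ↪o Fin n) (x : Fin k), c (π ⟨0, by omega⟩) ≤ c (π x) := by
    intro c x
    rw [OrderEmbedding.le_iff_le, hst.2 ⟨0, by omega⟩ (by simp only; omega)]
    exact Fin.le_def.2 (Nat.zero_le _)
  -- Otherwise the top of `a` would lie on `b` strictly below the top of `b`; since each top carries
  -- the least label of its instance, the two tops would coincide.
  have hle : ∀ x y : Fin k, (a ∘ π) x = (b ∘ π) y → (y : ℕ) ≤ x := by
    intro x y hxy
    by_contra hlt
    push Not at hlt
    have h1 := ha.eq_of_eq hb hxy x le_rfl hlt.le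
    simp only [Nat.sub_self, Function.comp_apply] at h1
    have h2 : a (π ⟨0, by omega⟩) = b (π ⟨0, by omega⟩) :=
      le_antisymm (h ▸ hmin a _) (h1 ▸ hmin b _)
    have h3 := congrArg Fin.val (hbi (h1.symm.trans h2))
    simp only at h3
    omega
  obtain ⟨j, hjk, hj⟩ := ha.exists_overlap hb hai hi h hle
  rcases Nat.eq_zero_or_pos i with rfl | hi0
  · refine ⟨j, hjk, fun x y => ?_⟩
    rw [hj, add_zero, ← Fin.ext_iff]
    exact ⟨fun h => ⟨h.1, h.1 ▸ h.2⟩, fun h => ⟨h.1, h.1 ▸ h.2⟩⟩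
  · have h1 := two_mul_le_of_overlap hai hbi fun x y hxy => ((hj x y).1 hxy).2
    -- A shift by `i` leaves room for at most `k - i` common vertices.
    have hik : i + s < k := by
      by_contra hcon
      push Not at hcon
      have h2 := two_mul_le_of_overlap (j := k - i) hai hbi fun x y hxy => by
        have := ((hj x y).1 hxy).1
        omega
      omega
    refine absurd ⟨i, hi0, by omega, ?_⟩ htail
    have key : ∀ l : Fin (s + 1), a (π ⟨i + l, by omega⟩) = b (π ⟨l, by omega⟩) := fun l =>
      (hj ⟨i + l, by omega⟩ ⟨l, by omega⟩).2 ⟨Nat.add_comm _ _, by simp only; omega⟩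
    have hmono : StrictMono fun l : Fin (s + 1) => π ⟨l, by omega⟩ := fun l l' hl =>
      hst.apply_lt_apply (Fin.lt_def.2 hl) (by simp only; omega)
    intro l l'
    rw [← a.lt_iff_lt, key, key, b.lt_iff_lt]
    exact hmono.lt_iff_lt

theorem exists_branching {n k s : ℕ} {F : RootedForest n} {π : Equiv.Perm (Fin k)}
    (hs : 1 ≤ s) (hst : StartsWithIdentity π s) (htail : ¬ TailConsecContainsIdentity π (s + 1))
    (hn : n + s < 2 * k) {a b : Fin k ↪o Fin n} (ha : IsPath F (a ∘ π)) (hb : IsPath F (b ∘ π)) :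
    ∃ j ≤ k, Branching (a ∘ π) (b ∘ π) j := by
  have hmeet : ∃ x y, (a ∘ π) x = (b ∘ π) y := by
    by_contra hcon
    push Not at hcon
    have := two_mul_le_of_overlap (j := 0) (a.injective.comp π.injective)
      (b.injective.comp π.injective) fun x y hxy => absurd hxy (hcon x y)
    omega
  obtain ⟨x, y, hxy⟩ := hmeet
  rcases le_total (y : ℕ) x with hle | hle
  · have := ha.eq_of_eq hb hxy y hle le_rfl
    simp only [Nat.sub_self] at this
    exact exists_branching_of_apply_eq hs hst htail hn ha hb _ this
  · have := hb.eq_of_eq ha hxy.symm x hle le_rfl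
    simp only [Nat.sub_self] at this
    obtain ⟨j, hj, h⟩ := exists_branching_of_apply_eq hs hst htail hn hb ha _ this
    exact ⟨j, hj, h.symm⟩

/-! ### Splitting the second moment by the overlap -/

/-- The set of values of the first `j` entries of `π`. -/
def prefixValues {k : ℕ} (π : Equiv.Perm (Fin k)) (j : ℕ) : Finset (Fin k) :=
  Finset.univ.filter fun x => (π.symm x : ℕ) < j

/-- Pairs of increasing sequences with values in `[n]` which agree exactly at the indices in `J`
and have no other common values. -/
abbrev GluedPairs {k : ℕ} (J : Finset (Fin k)) (n : ℕ) : Type :=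
  {p : (Fin k ↪o Fin n) × (Fin k ↪o Fin n) // ∀ x y, p.1 x = p.2 y ↔ x = y ∧ x ∈ J}

theorem branching_comp_iff {n k j : ℕ} {π : Equiv.Perm (Fin k)} {a b : Fin k → Fin n} :
    Branching (a ∘ π) (b ∘ π) j ↔ ∀ x y, a x = b y ↔ x = y ∧ x ∈ prefixValues π j := by
  constructor
  · intro h x y
    simpa [prefixValues] using h (π.symm x) (π.symm y)
  · intro h x y
    simpa [prefixValues] using h (π x) (π y)

theorem Branching.index_unique {α : Type*} {k i j : ℕ} {v w : Fin k → α} (hi : Branching v w i)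
    (hj : Branching v w j) (hik : i ≤ k) (hjk : j ≤ k) : i = j := by
  have key : ∀ {i j : ℕ}, Branching v w i → Branching v w j → i ≤ k → i ≤ j := by
    intro i j hi hj hik
    by_contra hlt
    push Not at hlt
    have h1 := (hi ⟨j, by omega⟩ ⟨j, by omega⟩).2 ⟨rfl, hlt⟩
    have h2 := ((hj _ _).1 h1).2
    simp at h2
  exact le_antisymm (key hi hj hik) (key hj hi hjk)

open scoped Classical in
/-- Contribution to `secondMoment` of the pairs of instances sharing exactly their first `j`
vertices. -/
noncomputable def branchSum {k : ℕ} (π : Equiv.Perm (Fin k)) (n j : ℕ) : ℕ :=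
  ∑ p : (Fin k ↪o Fin n) × (Fin k ↪o Fin n) with Branching (p.1 ∘ π) (p.2 ∘ π) j,
    pathCount (p.1 ∘ π) (p.2 ∘ π)

open scoped Classical in
/-- Contribution to `secondMoment` of the pairs of instances that do not branch off a common
initial segment. -/
noncomputable def offsetSum {k : ℕ} (π : Equiv.Perm (Fin k)) (n : ℕ) : ℕ :=
  ∑ p : (Fin k ↪o Fin n) × (Fin k ↪o Fin n) with ¬ ∃ j ≤ k, Branching (p.1 ∘ π) (p.2 ∘ π) j,
    pathCount (p.1 ∘ π) (p.2 ∘ π)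

theorem secondMoment_eq_branchSum_add {k : ℕ} (π : Equiv.Perm (Fin k)) (n : ℕ) :
    secondMoment π n = ∑ j ∈ Finset.range (k + 1), branchSum π n j + offsetSum π n := by
  classical
  rw [secondMoment_eq_sum, ← Finset.sum_filter_add_sum_filter_not Finset.univ
    (fun p : (Fin k ↪o Fin n) × (Fin k ↪o Fin n) => ∃ j ≤ k, Branching (p.1 ∘ π) (p.2 ∘ π) j)]
  unfold branchSum offsetSum
  congr 1
  rw [← Finset.sum_biUnion]
  · refine Finset.sum_congr ?_ fun _ _ => rfl
    ext p
    simp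
  · intro i hi j hj hij
    simp only [Finset.coe_range, Set.mem_Iio, Nat.lt_succ_iff] at hi hj
    rw [Function.onFun, Finset.disjoint_left]
    intro p hp hp'
    simp only [Finset.mem_filter, Finset.mem_univ, true_and] at hp hp'
    exact hij (hp.index_unique hp' hi hj)

theorem branchSum_eq_zero {k n j : ℕ} (π : Equiv.Perm (Fin k)) (h : n + j < 2 * k) :
    branchSum π n j = 0 := by
  classical
  refine Finset.sum_eq_zero fun p hp => ?_
  simp only [Finset.mem_filter, Finset.mem_univ, true_and] at hp
  have := two_mul_le_of_overlap (j := j) (p.1.injective.comp π.injective)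
    (p.2.injective.comp π.injective) fun x y hxy => by
      have := (hp x y).1 hxy
      rw [← this.1]
      exact this.2
  omega

/-- The constant is the common number of forests per pair; it does not involve `π`, which is what
allows comparing two permutations. -/
theorem exists_branchSum_eq {n k j : ℕ} (hj : 1 ≤ j) (hjk : j ≤ k) (hn : 2 * k - j ≤ n) :
    ∃ c, 0 < c ∧ ∀ π : Equiv.Perm (Fin k),
      branchSum π n j = c * Nat.card (GluedPairs (prefixValues π j) n) := by
  classical
  obtain ⟨c, hc, h⟩ := exists_pathCount_eq hj hjk hn
  refine ⟨c, hc, fun π => ?_⟩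
  rw [branchSum, Finset.sum_congr rfl fun p hp => h _ _ (p.1.injective.comp π.injective)
    (p.2.injective.comp π.injective) (by simpa using hp)]
  rw [Finset.sum_const, smul_eq_mul, mul_comm, Nat.card_eq_fintype_card, Fintype.card_subtype]
  congr 2
  ext p
  simp [branching_comp_iff]

theorem offsetSum_eq_zero {n k s : ℕ} {π : Equiv.Perm (Fin k)}
    (hs : 1 ≤ s) (hst : StartsWithIdentity π s) (htail : ¬ TailConsecContainsIdentity π (s + 1))
    (hn : n + s < 2 * k) : offsetSum π n = 0 := by
  classical
  refine Finset.sum_eq_zero fun p hp => ?_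
  simp only [Finset.mem_filter, Finset.mem_univ, true_and] at hp
  by_contra hpos
  obtain ⟨F, h1, h2⟩ := pathCount_pos_iff.1 (Nat.pos_of_ne_zero hpos)
  exact hp (exists_branching hs hst htail hn h1 h2)

/-- Two instances may overlap so that the second one starts at the second vertex of the first. -/
theorem offsetSum_pos {k s : ℕ} {π : Equiv.Perm (Fin k)} (hs : 1 ≤ s)
    (hsk : s < k) (hst : StartsWithIdentity π s) : 0 < offsetSum π (2 * k - s) := by
  classical
  let f : Fin k → Fin (2 * k - s) := fun x => ⟨x, by omega⟩
  -- The second instance reuses vertices `1, …, s` of the first, whose labels increase; its other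
  -- labels are shifted to at least `k`, above all labels of the first.
  let g : Fin k → Fin (2 * k - s) := fun x =>
    ⟨if h : (x : ℕ) < s then π ⟨x + 1, by omega⟩ else π x + (k - s), by
      split_ifs <;> omega⟩
  -- Labels for the fork in which the second chain hangs from vertex `s` of the first.
  let σ : Fin (2 * k - s) → Fin (2 * k - s) := fun y =>
    ⟨if h : (y : ℕ) < k then π ⟨y, h⟩ else π ⟨y - k + s, by omega⟩ + (k - s), by
      split_ifs <;> omega⟩
  have hσ : Function.Injective σ := by
    intro x y hxy
    simp only [σ, Fin.ext_iff] at hxy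
    split_ifs at hxy with h1 h2 h2
    · rw [← Fin.ext_iff, π.injective.eq_iff, Fin.mk.injEq] at hxy
      exact Fin.ext hxy
    · have := hst.le_apply (x := ⟨y - k + s, by omega⟩) (by simp)
      omega
    · have := hst.le_apply (x := ⟨x - k + s, by omega⟩) (by simp)
      omega
    · rw [Nat.add_right_cancel_iff, ← Fin.ext_iff, π.injective.eq_iff, Fin.mk.injEq] at hxy
      ext
      omega
  let τ : Equiv.Perm (Fin (2 * k - s)) := Equiv.ofBijective σ (Finite.injective_iff_bijective.1 hσ)
  let v₀ : Fin k → Fin (2 * k - s) := fun x => ⟨x, by omega⟩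
  let w₀ : Fin k → Fin (2 * k - s) := fun x =>
    ⟨if (x : ℕ) < s then x + 1 else k + (x - s), by split_ifs <;> omega⟩
  have hτv : τ ∘ v₀ = f ∘ π := by
    ext x
    simp [τ, σ, v₀, f]
  have hτw : τ ∘ w₀ = g := by
    ext x
    simp only [τ, σ, w₀, g, Function.comp_apply, Equiv.ofBijective_apply]
    by_cases hx : (x : ℕ) < s
    · simp [hx, show (x : ℕ) + 1 < k by omega]
    · simp only [hx, if_false, dif_neg, not_false_eq_true]
      rw [dif_neg (by omega)]
      congr 4
      omega
  have hf : StrictMono f := fun x y hxy => hxy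
  have hg : SameOrder g π := by
    rw [sameOrder_iff_strictMono]
    intro x y hxy
    obtain ⟨x, rfl⟩ := π.surjective x
    obtain ⟨y, rfl⟩ := π.surjective y
    simp only [Function.comp_apply, Equiv.symm_apply_apply, g, Fin.mk_lt_mk]
    by_cases hx : (x : ℕ) < s
    · by_cases hy : (y : ℕ) < s
      · rw [dif_pos hx, dif_pos hy]
        rw [hst.2 x hx, hst.2 y hy] at hxy
        exact hst.apply_lt_apply (by simpa using hxy) (by simp only; omega)
      · rw [dif_pos hx, dif_neg hy]
        have := hst.le_apply (x := y) (by omega)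
        omega
    · by_cases hy : (y : ℕ) < s
      · have := hst.le_apply (x := x) (by omega)
        rw [hst.2 y hy] at hxy
        omega
      · rw [dif_neg hx, dif_neg hy]
        omega
  let a : Fin k ↪o Fin (2 * k - s) := OrderEmbedding.ofStrictMono f hf
  let b : Fin k ↪o Fin (2 * k - s) :=
    OrderEmbedding.ofStrictMono (g ∘ π.symm) (sameOrder_iff_strictMono.1 hg)
  have hbπ : b ∘ π = g := by
    ext x
    simp [b]
  refine Finset.sum_pos' (fun _ _ => Nat.zero_le _) ⟨(a, b), ?_, ?_⟩
  · simp only [Finset.mem_filter, Finset.mem_univ, true_and]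
    rintro ⟨j, -, hj⟩
    rw [hbπ] at hj
    have := (hj ⟨1, by omega⟩ ⟨0, by omega⟩).1 (by
      simp [a, f, g, show 0 < s by omega])
    simp at this
  · rw [pathCount_pos_iff]
    refine ⟨(forkForest (2 * k - s) k s hsk).relabel τ, ?_, ?_⟩
    · have : IsPath (forkForest (2 * k - s) k s hsk) v₀ :=
        isPath_forkForest _ fun i hi => Or.inr ⟨hi.ne, rfl⟩
      have h2 := this.relabel τ
      rwa [hτv] at h2
    · have : IsPath (forkForest (2 * k - s) k s hsk) w₀ := by
        refine isPath_forkForest _ fun i hi => ?_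
        simp only [w₀]
        split_ifs <;> omega
      have h2 := this.relabel τ
      rwa [hτw, ← hbπ] at h2

/-- Choosing the set of used values splits off the number of values. -/
theorem card_gluedPairs_eq_mul {k : ℕ} (J : Finset (Fin k)) (n : ℕ) :
    Nat.card (GluedPairs J n) =
      Nat.card (Fin (2 * k - J.card) ↪o Fin n) * Nat.card (GluedPairs J (2 * k - J.card)) := by
  classical
  rw [← Nat.card_prod]
  have himg : ∀ {n : ℕ} (p : GluedPairs J n),
      (Finset.univ.image p.1.1 ∪ Finset.univ.image p.1.2).card = 2 * k - J.card := by
    intro n p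
    have h1 := Finset.card_union_add_card_inter (Finset.univ.image p.1.1) (Finset.univ.image p.1.2)
    have h2 : Finset.univ.image p.1.1 ∩ Finset.univ.image p.1.2 = J.image p.1.1 := by
      ext z
      simp only [Finset.mem_inter, Finset.mem_image, Finset.mem_univ, true_and]
      constructor
      · rintro ⟨⟨x, rfl⟩, y, hy⟩
        exact ⟨x, ((p.2 x y).1 hy.symm).2, rfl⟩
      · rintro ⟨x, hx, rfl⟩
        exact ⟨⟨x, rfl⟩, x, ((p.2 x x).2 ⟨rfl, hx⟩).symm⟩
    rw [h2, Finset.card_image_of_injective _ p.1.1.injective,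
      Finset.card_image_of_injective _ p.1.1.injective,
      Finset.card_image_of_injective _ p.1.2.injective] at h1
    simp only [Finset.card_univ, Fintype.card_fin] at h1
    omega
  let f : (Fin (2 * k - J.card) ↪o Fin n) × GluedPairs J (2 * k - J.card) → GluedPairs J n :=
    fun q => ⟨(q.2.1.1.trans q.1, q.2.1.2.trans q.1), fun x y => by simpa using q.2.2 x y⟩
  refine (Nat.card_congr (Equiv.ofBijective f ⟨?_, ?_⟩)).symm
  · rintro ⟨e, p⟩ ⟨e', p'⟩ h
    have h1 : p.1.1.trans e = p'.1.1.trans e' := congrArg (fun q => q.1.1) h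
    have h2 : p.1.2.trans e = p'.1.2.trans e' := congrArg (fun q => q.1.2) h
    -- The union has as many elements as there are values, so every value is used.
    have hcov : ∀ p : GluedPairs J (2 * k - J.card), ∀ z, (∃ x, p.1.1 x = z) ∨ ∃ x, p.1.2 x = z := by
      intro p z
      have := (Finset.card_eq_iff_eq_univ _).1 ((himg p).trans (Fintype.card_fin _).symm)
      have hz := this ▸ Finset.mem_univ z
      simpa using hz
    have hee : ∀ (p p' : GluedPairs J (2 * k - J.card)) (e e' : Fin (2 * k - J.card) ↪o Fin n),
        p.1.1.trans e = p'.1.1.trans e' → p.1.2.trans e = p'.1.2.trans e' →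
        Set.range e ⊆ Set.range e' := by
      rintro p p' e e' h1 h2 _ ⟨z, rfl⟩
      rcases hcov p z with ⟨x, rfl⟩ | ⟨x, rfl⟩
      · exact ⟨p'.1.1 x, (DFunLike.congr_fun h1 x).symm⟩
      · exact ⟨p'.1.2 x, (DFunLike.congr_fun h2 x).symm⟩
    have he : e = e' := by
      have hr : Set.range e = Set.range e' :=
        Set.Subset.antisymm (hee p p' e e' h1 h2) (hee p' p e' e h1.symm h2.symm)
      have hc : (Finset.univ.image e').card = 2 * k - J.card := by
        rw [Finset.card_image_of_injective _ e'.injective]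
        simp
      rw [Finset.orderEmbOfFin_unique' hc (f := e) fun x => by
        have : e x ∈ Set.range e' := hr ▸ Set.mem_range_self x
        simpa using this]
      exact (Finset.orderEmbOfFin_unique' hc fun x => by simp).symm
    subst he
    refine Prod.ext rfl (Subtype.ext (Prod.ext ?_ ?_))
    · ext x : 1
      exact e.injective (DFunLike.congr_fun h1 x)
    · ext x : 1
      exact e.injective (DFunLike.congr_fun h2 x)
  · intro p
    let e := Finset.orderEmbOfFin _ (himg p)
    have hr : Set.range e = _ := Finset.range_orderEmbOfFin _ (himg p)
    have h1 : ∀ x, ∃ z, e z = p.1.1 x := fun x => by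
      change p.1.1 x ∈ Set.range e
      rw [hr]
      simp
    have h2 : ∀ x, ∃ z, e z = p.1.2 x := fun x => by
      change p.1.2 x ∈ Set.range e
      rw [hr]
      simp
    choose a ha using h1
    choose b hb using h2
    have ham : StrictMono a := fun x y hxy => by
      rw [← e.lt_iff_lt, ha, ha]
      exact p.1.1.strictMono hxy
    have hbm : StrictMono b := fun x y hxy => by
      rw [← e.lt_iff_lt, hb, hb]
      exact p.1.2.strictMono hxy
    refine ⟨(e, ⟨(OrderEmbedding.ofStrictMono a ham, OrderEmbedding.ofStrictMono b hbm),
      fun x y => ?_⟩), Subtype.ext (Prod.ext ?_ ?_)⟩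
    · rw [← p.2 x y, ← ha, ← hb]
      simp
    · ext x : 1
      exact ha x
    · ext x : 1
      exact hb x

open Finset

/-! ### Glued pairs as balanced sets -/

/-- The first position of the `x`-th block, where indices in `K` own two positions and all other
indices own one. -/
def blockStart (K : Finset ℕ) (x : ℕ) : ℕ := x + #{y ∈ K | y < x}

theorem blockStart_zero (K : Finset ℕ) : blockStart K 0 = 0 := by simp [blockStart]

theorem blockStart_succ_of_mem {K : Finset ℕ} {x : ℕ} (h : x ∈ K) :
    blockStart K (x + 1) = blockStart K x + 2 := by
  have : {y ∈ K | y < x + 1} = insert x {y ∈ K | y < x} := by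
    ext y
    simp only [mem_filter, mem_insert, Nat.lt_succ_iff_lt_or_eq]
    constructor
    · rintro ⟨h1, h2 | h2⟩
      · exact Or.inr ⟨h1, h2⟩
      · exact Or.inl h2
    · rintro (rfl | ⟨h1, h2⟩)
      · exact ⟨h, Or.inr rfl⟩
      · exact ⟨h1, Or.inl h2⟩
  rw [blockStart, blockStart, this, card_insert_of_notMem (by simp)]
  omega

theorem blockStart_succ_of_notMem {K : Finset ℕ} {x : ℕ} (h : x ∉ K) :
    blockStart K (x + 1) = blockStart K x + 1 := by
  have : {y ∈ K | y < x + 1} = {y ∈ K | y < x} := by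
    refine filter_congr fun y hy => ?_
    have : y ≠ x := fun h' => h (h' ▸ hy)
    omega
  rw [blockStart, blockStart, this]
  omega

theorem blockStart_strictMono (K : Finset ℕ) : StrictMono (blockStart K) :=
  strictMono_nat_of_lt_succ fun x => by
    by_cases h : x ∈ K
    · rw [blockStart_succ_of_mem h]
      omega
    · rw [blockStart_succ_of_notMem h]
      omega

theorem blockStart_of_subset_range {K : Finset ℕ} {k : ℕ} (h : K ⊆ range k) :
    blockStart K k = k + #K := by
  rw [blockStart, filter_true_of_mem fun y hy => mem_range.1 (h hy)]

/-- The `k`-subsets of `[k + |K|]` whose `x`-th element is `blockStart K x` for all `x ∉ K`. -/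
def balancedSets (k : ℕ) (K : Finset ℕ) : Finset (Finset ℕ) :=
  {A ∈ powersetCard k (range (k + #K)) |
    ∀ x < k, x ∉ K → blockStart K x ∈ A ∧ #{y ∈ A | y < blockStart K x} = x}

theorem mem_balancedSets {k : ℕ} {K A : Finset ℕ} :
    A ∈ balancedSets k K ↔ A ⊆ range (k + #K) ∧ #A = k ∧
      ∀ x < k, x ∉ K → blockStart K x ∈ A ∧ #{y ∈ A | y < blockStart K x} = x := by
  rw [balancedSets, mem_filter, mem_powersetCard, and_assoc]

/-! ### Increasing sequences and their sets of values -/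

section Values

/-- The values of an increasing sequence, as natural numbers. -/
def valueSet {k n : ℕ} (a : Fin k ↪o Fin n) : Finset ℕ := univ.image fun x => (a x : ℕ)

theorem val_apply_injective {k n : ℕ} (a : Fin k ↪o Fin n) :
    Function.Injective fun x => (a x : ℕ) := Fin.val_injective.comp a.injective

theorem mem_valueSet {k n : ℕ} {a : Fin k ↪o Fin n} {z : ℕ} :
    z ∈ valueSet a ↔ ∃ x, (a x : ℕ) = z := by simp [valueSet]

theorem card_valueSet {k n : ℕ} (a : Fin k ↪o Fin n) : #(valueSet a) = k := by
  rw [valueSet, card_image_of_injective _ (val_apply_injective a)]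
  simp

theorem valueSet_subset {k n : ℕ} (a : Fin k ↪o Fin n) : valueSet a ⊆ range n := by
  intro z hz
  obtain ⟨x, rfl⟩ := mem_valueSet.1 hz
  simp

theorem card_valueSet_filter_lt {k n : ℕ} (a : Fin k ↪o Fin n) (x : Fin k) :
    #{z ∈ valueSet a | z < (a x : ℕ)} = x := by
  have : {z ∈ valueSet a | z < (a x : ℕ)} = (Iio x).image fun y => (a y : ℕ) := by
    ext z
    simp only [mem_filter, mem_valueSet, mem_image, mem_Iio]
    constructor
    · rintro ⟨⟨y, rfl⟩, hy⟩
      exact ⟨y, by simpa using hy, rfl⟩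
    · rintro ⟨y, hy, rfl⟩
      exact ⟨⟨y, rfl⟩, by simpa using hy⟩
  rw [this, card_image_of_injective _ (val_apply_injective a), Fin.card_Iio]

theorem val_eq_of_card_filter_lt {k n z : ℕ} {a : Fin k ↪o Fin n} {x : Fin k}
    (h : z ∈ valueSet a) (hx : #{y ∈ valueSet a | y < z} = x) : (a x : ℕ) = z := by
  obtain ⟨y, rfl⟩ := mem_valueSet.1 h
  rw [card_valueSet_filter_lt] at hx
  rw [Fin.ext hx]

theorem valueSet_injective {k n : ℕ} :
    Function.Injective (valueSet : (Fin k ↪o Fin n) → Finset ℕ) := by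
  intro a a' h
  ext x
  refine (val_eq_of_card_filter_lt (a := a') (x := x) ?_ ?_).symm
  · rw [← h]
    exact mem_valueSet.2 ⟨x, rfl⟩
  · rw [← h, card_valueSet_filter_lt]

theorem exists_valueSet_eq {k n : ℕ} {A : Finset ℕ} (hA : A ⊆ range n) (hk : #A = k) :
    ∃ a : Fin k ↪o Fin n, valueSet a = A := by
  have h : ∀ x, A.orderEmbOfFin hk x < n := fun x =>
    mem_range.1 (hA (orderEmbOfFin_mem A hk x))
  refine ⟨OrderEmbedding.ofStrictMono (fun x => ⟨A.orderEmbOfFin hk x, h x⟩) fun x y hxy => ?_, ?_⟩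
  · exact Fin.mk_lt_mk.2 ((A.orderEmbOfFin hk).strictMono hxy)
  · refine eq_of_subset_of_card_le ?_ ?_
    · intro z hz
      obtain ⟨x, rfl⟩ := mem_valueSet.1 hz
      exact orderEmbOfFin_mem A hk x
    · rw [card_valueSet, hk]

end Values

/-! ### The bijection between glued pairs and balanced sets -/

section Bijection

variable {k t : ℕ} {J : Finset (Fin k)} {K : Finset ℕ}

theorem card_filter_lt_add_card_filter_lt (hJ : ∀ x : Fin k, x ∈ J ↔ (x : ℕ) ∉ K) (x : Fin k) :
    #{y ∈ J | y < x} + #{y ∈ K | y < (x : ℕ)} = x := by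
  have h1 : #{y ∈ J | y < x} = #{y ∈ range x | y ∉ K} := by
    rw [← card_map Fin.valEmbedding]
    congr 1
    ext z
    simp only [mem_map, mem_filter, Fin.valEmbedding_apply, mem_range]
    constructor
    · rintro ⟨y, ⟨h1, h2⟩, rfl⟩
      exact ⟨h2, (hJ y).1 h1⟩
    · rintro ⟨h1, h2⟩
      exact ⟨⟨z, by omega⟩, ⟨(hJ _).2 h2, h1⟩, rfl⟩
  have h2 : {y ∈ K | y < (x : ℕ)} = {y ∈ range x | y ∈ K} := by
    ext z
    simp [and_comm]
  rw [h1, h2, add_comm, card_filter_add_card_filter_not, card_range]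

theorem valueSet_inter_valueSet (p : GluedPairs J t) :
    valueSet p.1.1 ∩ valueSet p.1.2 = J.image fun x => (p.1.1 x : ℕ) := by
  ext z
  simp only [mem_inter, mem_valueSet, mem_image]
  constructor
  · rintro ⟨⟨x, rfl⟩, y, hy⟩
    exact ⟨x, ((p.2 x y).1 (Fin.ext hy.symm)).2, rfl⟩
  · rintro ⟨x, hx, rfl⟩
    exact ⟨⟨x, rfl⟩, x, by rw [(p.2 x x).2 ⟨rfl, hx⟩]⟩

theorem card_add_card_of_compl (hJ : ∀ x : Fin k, x ∈ J ↔ (x : ℕ) ∉ K) (hK : K ⊆ range k) :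
    #J + #K = k := by
  have h1 : J.map Fin.valEmbedding = range k \ K := by
    ext z
    simp only [mem_map, Fin.valEmbedding_apply, mem_sdiff, mem_range]
    constructor
    · rintro ⟨y, h1, rfl⟩
      exact ⟨y.2, (hJ y).1 h1⟩
    · rintro ⟨h1, h2⟩
      exact ⟨⟨z, h1⟩, (hJ _).2 h2, rfl⟩
  rw [← card_map Fin.valEmbedding, h1, card_sdiff_of_subset hK, card_range]
  have := card_le_card hK
  rw [card_range] at this
  omega

theorem valueSet_union_valueSet (hJ : ∀ x : Fin k, x ∈ J ↔ (x : ℕ) ∉ K) (hK : K ⊆ range k)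
    (ht : t = k + #K) (p : GluedPairs J t) :
    valueSet p.1.1 ∪ valueSet p.1.2 = range t := by
  refine eq_of_subset_of_card_le (union_subset (valueSet_subset _) (valueSet_subset _)) ?_
  have h1 := card_union_add_card_inter (valueSet p.1.1) (valueSet p.1.2)
  rw [valueSet_inter_valueSet, card_image_of_injective _ (val_apply_injective p.1.1),
    card_valueSet, card_valueSet] at h1
  have := card_add_card_of_compl hJ hK
  rw [card_range]
  omega

/-- All positions are used, and below a shared value lie two values for each smaller index in `K`
and one for each smaller shared index. So the shared values are forced. -/
theorem apply_eq_blockStart (hJ : ∀ x : Fin k, x ∈ J ↔ (x : ℕ) ∉ K) (hK : K ⊆ range k)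
    (ht : t = k + #K) (p : GluedPairs J t) {x : Fin k} (hx : x ∈ J) :
    (p.1.1 x : ℕ) = blockStart K x := by
  have h1 := card_union_add_card_inter {z ∈ valueSet p.1.1 | z < (p.1.1 x : ℕ)}
    {z ∈ valueSet p.1.2 | z < (p.1.1 x : ℕ)}
  rw [← filter_union, ← filter_inter_distrib, valueSet_union_valueSet hJ hK ht,
    valueSet_inter_valueSet, card_valueSet_filter_lt] at h1
  have h2 : {z ∈ range t | z < (p.1.1 x : ℕ)} = range (p.1.1 x) := by
    ext z
    simp only [mem_filter, mem_range]
    omega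
  have h3 : #{z ∈ J.image (fun y => (p.1.1 y : ℕ)) | z < (p.1.1 x : ℕ)} = #{y ∈ J | y < x} := by
    rw [filter_image, card_image_of_injective _ (val_apply_injective p.1.1)]
    simp
  have h4 : #{z ∈ valueSet p.1.2 | z < (p.1.1 x : ℕ)} = x := by
    rw [(p.2 x x).2 ⟨rfl, hx⟩, card_valueSet_filter_lt]
  rw [h2, h3, h4, card_range] at h1
  have := card_filter_lt_add_card_filter_lt hJ x
  rw [blockStart]
  omega

/-- A glued pair is determined by the values of its first sequence: the second takes the complement
together with the shared values. -/
theorem card_gluedPairs (hJ : ∀ x : Fin k, x ∈ J ↔ (x : ℕ) ∉ K) (hK : K ⊆ range k)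
    (ht : t = k + #K) : Nat.card (GluedPairs J t) = #(balancedSets k K) := by
  classical
  rw [Nat.card_eq_fintype_card, ← card_univ]
  refine card_bij (fun p _ => valueSet p.1.1) ?_ ?_ ?_
  · intro p _
    refine mem_balancedSets.2 ⟨ht ▸ valueSet_subset _, card_valueSet _, fun x hx hxK => ?_⟩
    have := apply_eq_blockStart hJ hK ht p (x := ⟨x, hx⟩) ((hJ _).2 hxK)
    simp only at this
    rw [← this]
    exact ⟨mem_valueSet.2 ⟨_, rfl⟩, card_valueSet_filter_lt _ _⟩
  · intro p _ p' _ h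
    have h1 : p.1.1 = p'.1.1 := valueSet_injective h
    have key : ∀ p : GluedPairs J t, valueSet p.1.2 =
        (range t \ valueSet p.1.1) ∪ J.image fun x => (p.1.1 x : ℕ) := by
      intro p
      rw [← valueSet_union_valueSet hJ hK ht p, ← valueSet_inter_valueSet]
      ext z
      simp only [mem_union, mem_sdiff, mem_inter]
      tauto
    refine Subtype.ext (Prod.ext h1 (valueSet_injective ?_))
    rw [key, key, h1]
  · intro A hA
    obtain ⟨hAt, hAk, hAd⟩ := mem_balancedSets.1 hA
    rw [← ht] at hAt
    have hd := blockStart_strictMono K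
    set D := (range k \ K).image (blockStart K) with hD
    have hDA : D ⊆ A := by
      intro z hz
      obtain ⟨x, hx, rfl⟩ := mem_image.1 hz
      rw [mem_sdiff, mem_range] at hx
      exact (hAd x hx.1 hx.2).1
    have hcK := card_le_card hK
    rw [card_range] at hcK
    -- `D` is the set of shared values and `range t \ A ∪ D` the value set of the second sequence.
    have hBd : Disjoint (range t \ A) D :=
      disjoint_left.2 fun z hz hz' => (mem_sdiff.1 hz).2 (hDA hz')
    have hBk : #(range t \ A ∪ D) = k := by
      rw [card_union_of_disjoint hBd, card_sdiff_of_subset hAt, hD,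
        card_image_of_injective _ hd.injective, card_sdiff_of_subset hK, card_range, card_range, hAk]
      omega
    have hBt : range t \ A ∪ D ⊆ range t := union_subset sdiff_subset (hDA.trans hAt)
    obtain ⟨a, ha⟩ := exists_valueSet_eq hAt hAk
    obtain ⟨b, hb⟩ := exists_valueSet_eq hBt hBk
    have hax : ∀ x ∈ J, (a x : ℕ) = blockStart K x := fun x hx => by
      have := hAd x x.2 ((hJ x).1 hx)
      refine val_eq_of_card_filter_lt ?_ ?_
      · rw [ha]
        exact this.1
      · rw [ha]
        exact this.2
    have hbx : ∀ x ∈ J, (b x : ℕ) = blockStart K x := fun x hx => by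
      refine val_eq_of_card_filter_lt ?_ ?_
      · rw [hb]
        exact mem_union_right _ (mem_image_of_mem _ (by simpa using (hJ x).1 hx))
      · have hlt : blockStart K x ≤ t := by
          rw [ht, ← blockStart_of_subset_range hK]
          exact hd.monotone x.2.le
        have h1 : {y ∈ range t \ A | y < blockStart K x} =
            range (blockStart K x) \ {y ∈ A | y < blockStart K x} := by
          ext z
          simp only [mem_filter, mem_sdiff, mem_range]
          constructor
          · rintro ⟨⟨h1, h2⟩, h3⟩
            exact ⟨h3, fun h => h2 h.1⟩
          · rintro ⟨h1, h2⟩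
            exact ⟨⟨h1.trans_le hlt, fun h => h2 ⟨h, h1⟩⟩, h1⟩
        -- Ranks in the second set: the complement contributes `blockStart K x - x`, the number of
        -- smaller indices in `K`, and `D` the number of smaller shared indices; together `x`.
        have h2 : #{y ∈ D | y < blockStart K x} = #{y ∈ J | y < x} := by
          rw [hD, filter_image, card_image_of_injective _ hd.injective,
            ← card_map Fin.valEmbedding (s := {y ∈ J | y < x})]
          congr 1
          ext z
          simp only [mem_map, mem_filter, Fin.valEmbedding_apply, mem_sdiff, mem_range,
            hd.lt_iff_lt]
          constructor
          · rintro ⟨⟨h1, h2⟩, h3⟩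
            exact ⟨⟨z, h1⟩, ⟨(hJ _).2 h2, h3⟩, rfl⟩
          · rintro ⟨y, ⟨h1, h2⟩, rfl⟩
            exact ⟨⟨y.2, (hJ y).1 h1⟩, h2⟩
        rw [hb, filter_union, card_union_of_disjoint
          (disjoint_filter_filter hBd), h1, h2, card_sdiff_of_subset
          (fun z hz => mem_range.2 (mem_filter.1 hz).2), card_range,
          (hAd x x.2 ((hJ x).1 hx)).2]
        have := card_filter_lt_add_card_filter_lt hJ x
        rw [blockStart]
        omega
    refine ⟨⟨(a, b), fun x y => ⟨fun hxy => ?_, ?_⟩⟩, mem_univ _, ha⟩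
    · have h1 : (a x : ℕ) ∈ A := ha ▸ mem_valueSet.2 ⟨x, rfl⟩
      have h2 : (a x : ℕ) ∈ range t \ A ∪ D := hb ▸ mem_valueSet.2 ⟨y, by rw [hxy]⟩
      rcases mem_union.1 h2 with h2 | h2
      · exact absurd h1 (mem_sdiff.1 h2).2
      · obtain ⟨z, hz, hz'⟩ := mem_image.1 h2
        rw [mem_sdiff, mem_range] at hz
        have hzJ : (⟨z, hz.1⟩ : Fin k) ∈ J := (hJ _).2 hz.2
        have h3 : x = ⟨z, hz.1⟩ := a.injective (Fin.ext (by rw [hax _ hzJ, hz']))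
        have h4 : y = ⟨z, hz.1⟩ := b.injective (Fin.ext (by rw [hbx _ hzJ, hz', hxy]))
        exact ⟨h3.trans h4.symm, h3 ▸ hzJ⟩
    · rintro ⟨rfl, hx⟩
      exact Fin.ext ((hax x hx).trans (hbx x hx).symm)

end Bijection


/-! ### Counting balanced sets -/

section Counting

variable {k : ℕ} {K : Finset ℕ}

theorem blockStart_lt_of_lt (hK : K ⊆ range k) {x : ℕ} (hx : x < k) :
    blockStart K x < k + #K := by
  rw [← blockStart_of_subset_range hK]
  exact blockStart_strictMono K hx

theorem card_le_of_subset_range (hK : K ⊆ range k) : #K ≤ k := by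
  simpa using card_le_card hK

/-- Every balanced set contains the forced positions `D`; the rest is a choice of `|K|` out of
`2|K|` free positions. -/
theorem card_balancedSets_le (hK : K ⊆ range k) : #(balancedSets k K) ≤ (#K).centralBinom := by
  have hd := blockStart_strictMono K
  set D := (range k \ K).image (blockStart K) with hD
  have hcK := card_le_of_subset_range hK
  have hDc : #D = k - #K := by
    rw [hD, card_image_of_injective _ hd.injective, card_sdiff_of_subset hK, card_range]
  have hDt : D ⊆ range (k + #K) := by
    intro z hz
    obtain ⟨x, hx, rfl⟩ := mem_image.1 hz
    exact mem_range.2 (blockStart_lt_of_lt hK (mem_range.1 (mem_sdiff.1 hx).1))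
  have hDA : ∀ A ∈ balancedSets k K, D ⊆ A := by
    intro A hA z hz
    obtain ⟨x, hx, rfl⟩ := mem_image.1 hz
    rw [mem_sdiff, mem_range] at hx
    exact ((mem_balancedSets.1 hA).2.2 x hx.1 hx.2).1
  have hcard : #(powersetCard #K (range (k + #K) \ D)) = (#K).centralBinom := by
    rw [card_powersetCard, card_sdiff_of_subset hDt, card_range, hDc, Nat.centralBinom]
    congr 1
    omega
  rw [← hcard]
  refine card_le_card_of_injOn (fun A => A \ D) ?_ ?_
  · intro A hA
    have h := mem_balancedSets.1 hA
    refine mem_powersetCard.2 ⟨sdiff_subset_sdiff h.1 Subset.rfl, ?_⟩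
    rw [card_sdiff_of_subset (hDA A hA), h.2.1, hDc]
    omega
  · intro A hA B hB h
    rw [← sdiff_union_of_subset (hDA A hA), ← sdiff_union_of_subset (hDA B hB)]
    exact congrArg (· ∪ D) h

theorem image_mem_balancedSets {h : ℕ → ℕ}
    (hm : StrictMonoOn h (Set.Iio k)) (hlt : ∀ x < k, h x < k + #K)
    (heq : ∀ x < k, x ∉ K → h x = blockStart K x) : (range k).image h ∈ balancedSets k K := by
  have hinj : Set.InjOn h (range k) := by
    intro x hx y hy hxy
    exact hm.injOn (by simpa using hx) (by simpa using hy) hxy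
  refine mem_balancedSets.2 ⟨?_, ?_, fun x hx hxK => ?_⟩
  · intro z hz
    obtain ⟨x, hx, rfl⟩ := mem_image.1 hz
    exact mem_range.2 (hlt x (mem_range.1 hx))
  · rw [card_image_of_injOn hinj, card_range]
  · rw [← heq x hx hxK]
    refine ⟨mem_image_of_mem _ (mem_range.2 hx), ?_⟩
    rw [filter_image, card_image_of_injOn (hinj.mono (coe_subset.2 (filter_subset _ _)))]
    have : {y ∈ range k | h y < h x} = range x := by
      ext y
      simp only [mem_filter, mem_range]
      constructor
      · rintro ⟨h1, h2⟩
        exact (hm.lt_iff_lt h1 hx).1 h2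
      · intro h1
        exact ⟨h1.trans hx, hm (h1.trans hx) hx h1⟩
    rw [this, card_range]

/-- The sequence choosing in each block of size two the first position for indices in `T` and the
second one otherwise. -/
def blockChoice (K T : Finset ℕ) (x : ℕ) : ℕ :=
  blockStart K x + if x ∈ K ∧ x ∉ T then 1 else 0

theorem blockStart_le_blockChoice (K T : Finset ℕ) (x : ℕ) :
    blockStart K x ≤ blockChoice K T x := Nat.le_add_right _ _

theorem blockChoice_lt (K T : Finset ℕ) (x : ℕ) :
    blockChoice K T x < blockStart K (x + 1) := by
  rw [blockChoice]
  by_cases h : x ∈ K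
  · rw [blockStart_succ_of_mem h]
    split_ifs <;> omega
  · rw [blockStart_succ_of_notMem h, if_neg fun h' => h h'.1]
    omega

theorem blockChoice_strictMono (K T : Finset ℕ) : StrictMono (blockChoice K T) :=
  strictMono_nat_of_lt_succ fun x =>
    (blockChoice_lt K T x).trans_le (blockStart_le_blockChoice K T _)

theorem image_blockChoice_mem (hK : K ⊆ range k) (T : Finset ℕ) :
    (range k).image (blockChoice K T) ∈ balancedSets k K := by
  refine image_mem_balancedSets ((blockChoice_strictMono K T).strictMonoOn _) (fun x hx => ?_)
    fun x _ hxK => ?_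
  · rw [← blockStart_of_subset_range hK]
    exact (blockChoice_lt K T x).trans_le ((blockStart_strictMono K).monotone hx)
  · rw [blockChoice, if_neg fun h => hxK h.1, add_zero]

theorem blockStart_mem_image_blockChoice {T : Finset ℕ} {x : ℕ} (hx : x < k) (hxK : x ∈ K) :
    blockStart K x ∈ (range k).image (blockChoice K T) ↔ x ∈ T := by
  rw [mem_image]
  constructor
  · rintro ⟨y, -, hy⟩
    have hxy : y = x := by
      have h1 := blockChoice_lt K T y
      have h2 := blockStart_le_blockChoice K T y
      rw [hy] at h1 h2
      have h3 := (blockStart_strictMono K).lt_iff_lt.1 h1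
      have h4 := (blockStart_strictMono K).le_iff_le.1 h2
      omega
    subst hxy
    by_contra hT
    rw [blockChoice, if_pos ⟨hxK, hT⟩] at hy
    omega
  · intro hT
    refine ⟨x, mem_range.2 hx, ?_⟩
    rw [blockChoice, if_neg fun h => h.2 hT, add_zero]

theorem card_image_blockChoice (hK : K ⊆ range k) :
    #(K.powerset.image fun T => (range k).image (blockChoice K T)) = 2 ^ #K := by
  rw [card_image_of_injOn, card_powerset]
  intro T hT T' hT' h
  ext x
  have hT : T ⊆ K := mem_powerset.1 hT
  have hT' : T' ⊆ K := mem_powerset.1 hT'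
  by_cases hx : x ∈ K
  · have hxk := mem_range.1 (hK hx)
    rw [← blockStart_mem_image_blockChoice (T := T) hxk hx,
      ← blockStart_mem_image_blockChoice (T := T') hxk hx]
    simp only at h
    rw [h]
  · exact ⟨fun h => absurd (hT h) hx, fun h => absurd (hT' h) hx⟩

/-- One position from each double block always gives a balanced set, `2 ^ |K|` in all. Two adjacent
double blocks allow another: both positions of the first and none of the second. -/
theorem two_pow_card_lt_card_balancedSets (hK : K ⊆ range k) {x : ℕ} (hx : x ∈ K)
    (hx' : x + 1 ∈ K) : 2 ^ #K < #(balancedSets k K) := by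
  rw [← card_image_blockChoice hK]
  refine card_lt_card ((ssubset_iff_of_subset ?_).2 ?_)
  · intro A hA
    obtain ⟨T, -, rfl⟩ := mem_image.1 hA
    exact image_blockChoice_mem hK T
  -- The extra set: index `x + 1` moves down to the second position of block `x`.
  · let h : ℕ → ℕ := fun y => if y = x + 1 then blockStart K x + 1 else blockStart K y
    have hs1 := blockStart_succ_of_mem hx
    have hs2 := blockStart_succ_of_mem hx'
    have hd := blockStart_strictMono K
    have hm : StrictMono h := by
      refine strictMono_nat_of_lt_succ fun y => ?_
      simp only [h]
      have := hd (Nat.lt_succ_self y)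
      split_ifs with h1 h2 h2
      · omega
      · subst h1
        omega
      · have : y = x := by omega
        subst this
        omega
      · exact this
    refine ⟨(range k).image h, image_mem_balancedSets (hm.strictMonoOn _) (fun y hy => ?_)
      (fun y _ hyK => if_neg fun hyx : y = x + 1 => hyK (hyx ▸ hx')), fun hmem => ?_⟩
    · refine lt_of_le_of_lt ?_ (blockStart_lt_of_lt hK hy)
      simp only [h]
      split_ifs with h1
      · subst h1
        omega
      · exact le_rfl
    · obtain ⟨T, -, hT⟩ := mem_image.1 hmem
      have hxk := mem_range.1 (hK hx)
      have hxk' := mem_range.1 (hK hx')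
      have h1 : blockStart K x ∈ (range k).image (blockChoice K T) := by
        rw [hT]
        exact mem_image.2 ⟨x, mem_range.2 hxk, if_neg (by omega)⟩
      have h2 : blockStart K x + 1 ∈ (range k).image (blockChoice K T) := by
        rw [hT]
        exact mem_image.2 ⟨x + 1, mem_range.2 hxk', if_pos rfl⟩
      rw [blockStart_mem_image_blockChoice hxk hx] at h1
      obtain ⟨y, -, hy⟩ := mem_image.1 h2
      have h3 := blockChoice_lt K T y
      have h4 := blockStart_le_blockChoice K T y
      rw [hy] at h3 h4
      have h5 : blockStart K x < blockStart K (y + 1) := by omega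
      have h6 : blockStart K y < blockStart K (x + 1) := by omega
      have h7 := hd.lt_iff_lt.1 h5
      have h8 := hd.lt_iff_lt.1 h6
      have : y = x := by omega
      subst this
      rw [blockChoice, if_neg fun h => h.2 h1] at hy
      omega

/-- Each double block is bounded on either side by a forced position or an end of the range. The
ranks there force exactly one element in the block, so the set is determined by the blocks whose
first position it contains. -/
theorem card_balancedSets_eq_two_pow (hK : K ⊆ range k) (h : ∀ x ∈ K, x + 1 ∉ K) :
    #(balancedSets k K) = 2 ^ #K := by
  refine le_antisymm ?_ ?_
  · have hd := blockStart_strictMono K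
    have low : ∀ A ∈ balancedSets k K, ∀ x ∈ K, #{y ∈ A | y < blockStart K x} = x := by
      intro A hA x hx
      have hxk := mem_range.1 (hK hx)
      obtain ⟨-, -, hA⟩ := mem_balancedSets.1 hA
      rcases x with _ | x
      · simp [blockStart_zero]
      · have hxK : x ∉ K := fun h' => h x h' hx
        have h1 := hA x (by omega) hxK
        have : {y ∈ A | y < blockStart K (x + 1)} =
            insert (blockStart K x) {y ∈ A | y < blockStart K x} := by
          rw [blockStart_succ_of_notMem hxK]
          ext y
          simp only [mem_filter, mem_insert]
          constructor
          · rintro ⟨h2, h3⟩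
            rcases Nat.lt_succ_iff_lt_or_eq.1 h3 with h3 | h3
            · exact Or.inr ⟨h2, h3⟩
            · exact Or.inl h3
          · rintro (rfl | ⟨h2, h3⟩)
            · exact ⟨h1.1, by omega⟩
            · exact ⟨h2, by omega⟩
        rw [this, card_insert_of_notMem (by simp), h1.2]
    have high : ∀ A ∈ balancedSets k K, ∀ x ∈ K, #{y ∈ A | y < blockStart K (x + 1)} = x + 1 := by
      intro A hA x hx
      have hxk := mem_range.1 (hK hx)
      obtain ⟨h1, h2, hA⟩ := mem_balancedSets.1 hA
      rcases Nat.lt_or_ge (x + 1) k with hlt | hge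
      · exact (hA (x + 1) hlt (h x hx)).2
      · have hxk1 : x + 1 = k := by omega
        rw [hxk1, blockStart_of_subset_range hK, filter_true_of_mem fun y hy =>
          mem_range.1 (h1 hy), h2]
    have one : ∀ A ∈ balancedSets k K, ∀ x ∈ K,
        (blockStart K x + 1 ∈ A ↔ blockStart K x ∉ A) := by
      intro A hA x hx
      have h1 := low A hA x hx
      have h2 := high A hA x hx
      have : {y ∈ A | y < blockStart K (x + 1)} = {y ∈ A | y < blockStart K x} ∪
          {y ∈ ({blockStart K x, blockStart K x + 1} : Finset ℕ) | y ∈ A} := by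
        rw [blockStart_succ_of_mem hx]
        ext y
        simp only [mem_filter, mem_union, mem_insert, mem_singleton]
        constructor
        · rintro ⟨h3, h4⟩
          by_cases h5 : y < blockStart K x
          · exact Or.inl ⟨h3, h5⟩
          · exact Or.inr ⟨by omega, h3⟩
        · rintro (⟨h3, h4⟩ | ⟨h3, h4⟩)
          · exact ⟨h3, by omega⟩
          · exact ⟨h4, by omega⟩
      rw [this, card_union_of_disjoint, h1] at h2
      · by_cases h3 : blockStart K x ∈ A <;> by_cases h4 : blockStart K x + 1 ∈ A <;>
          simp_all [filter_insert, filter_singleton]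
      · rw [disjoint_left]
        intro y hy hy'
        simp only [mem_filter, mem_insert, mem_singleton] at hy hy'
        omega
    rw [← card_powerset]
    refine card_le_card_of_injOn (fun A => {x ∈ K | blockStart K x ∈ A}) ?_ ?_
    · intro A _
      exact mem_powerset.2 (filter_subset _ _)
    · have key : ∀ A ∈ balancedSets k K, ∀ B ∈ balancedSets k K,
          ({x ∈ K | blockStart K x ∈ A} : Finset ℕ) = {x ∈ K | blockStart K x ∈ B} →
          A ⊆ B := by
        intro A hA B hB hAB z hz
        have hK' : ∀ x ∈ K, (blockStart K x ∈ A ↔ blockStart K x ∈ B) := fun x hx => by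
          have := Finset.ext_iff.1 hAB x
          simpa [hx] using this
        have hzt : z < blockStart K k := by
          rw [blockStart_of_subset_range hK]
          exact mem_range.1 ((mem_balancedSets.1 hA).1 hz)
        obtain ⟨x, hxk, hx1, hx2⟩ : ∃ x < k, blockStart K x ≤ z ∧ z < blockStart K (x + 1) := by
          clear hz hA hAB hB one high low
          have : ∀ m, z < blockStart K m → ∃ x < m, blockStart K x ≤ z ∧
              z < blockStart K (x + 1) := by
            intro m
            induction m with
            | zero => simp [blockStart_zero]
            | succ m ih =>
              intro hm
              rcases Nat.lt_or_ge z (blockStart K m) with h1 | h1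
              · obtain ⟨x, hx, h2⟩ := ih h1
                exact ⟨x, by omega, h2⟩
              · exact ⟨m, by omega, h1, hm⟩
          exact this k hzt
        by_cases hxK : x ∈ K
        · rw [blockStart_succ_of_mem hxK] at hx2
          rcases Nat.eq_or_lt_of_le hx1 with h1 | h1
          · rw [← h1] at hz ⊢
            exact (hK' x hxK).1 hz
          · have h2 : z = blockStart K x + 1 := by omega
            rw [h2] at hz ⊢
            rw [one A hA x hxK, hK' x hxK] at hz
            exact (one B hB x hxK).2 hz
        · rw [blockStart_succ_of_notMem hxK] at hx2
          have h1 : z = blockStart K x := by omega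
          rw [h1]
          exact ((mem_balancedSets.1 hB).2.2 x hxk hxK).1
      intro A hA B hB hAB
      exact Subset.antisymm (key A hA B hB hAB) (key B hB A hA hAB.symm)
  · rw [← card_image_blockChoice hK]
    refine card_le_card fun A hA => ?_
    obtain ⟨T, -, rfl⟩ := mem_image.1 hA
    exact image_blockChoice_mem hK T

theorem blockStart_of_forall_le {x : ℕ} (h : ∀ y ∈ K, x ≤ y) : blockStart K x = x := by
  rw [blockStart, filter_false_of_mem fun y hy => by have := h y hy; omega]
  simp

/-- For a final interval all forced positions lie below the free ones, so the rank conditions hold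
for every choice and the general upper bound is attained. -/
theorem centralBinom_le_card_balancedSets_Ico {s : ℕ} (hs : s ≤ k) :
    (k - s).centralBinom ≤ #(balancedSets k (Ico s k)) := by
  have hcard : #(powersetCard (k - s) (Ico s (k + (k - s)))) = (k - s).centralBinom := by
    rw [card_powersetCard, Nat.card_Ico, Nat.centralBinom]
    congr 1
    omega
  rw [← hcard]
  have hd : ∀ S ∈ powersetCard (k - s) (Ico s (k + (k - s))), Disjoint (range s) S := by
    intro S hS
    rw [disjoint_left]
    intro y hy hyS
    have h1 := mem_Ico.1 ((mem_powersetCard.1 hS).1 hyS)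
    have h2 := mem_range.1 hy
    omega
  refine card_le_card_of_injOn (fun S => range s ∪ S) ?_ ?_
  · intro S hS
    have hS' := mem_powersetCard.1 hS
    refine mem_balancedSets.2 ⟨?_, ?_, fun x hx hxK => ?_⟩
    · intro z hz
      rw [Nat.card_Ico, mem_range]
      rcases mem_union.1 hz with hz | hz
      · have := mem_range.1 hz
        omega
      · exact (mem_Ico.1 (hS'.1 hz)).2
    · rw [card_union_of_disjoint (hd S hS), card_range, hS'.2]
      omega
    · have hxs : x < s := by
        by_contra hcon
        exact hxK (mem_Ico.2 ⟨by omega, hx⟩)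
      rw [blockStart_of_forall_le fun y hy => by have := mem_Ico.1 hy; omega]
      refine ⟨mem_union_left _ (mem_range.2 hxs), ?_⟩
      have : {y ∈ range s ∪ S | y < x} = range x := by
        ext y
        simp only [mem_filter, mem_union, mem_range]
        omega
      rw [this, card_range]
  · intro S hS S' hS' h
    have h1 := union_sdiff_cancel_left (hd S hS)
    have h2 := union_sdiff_cancel_left (hd S' hS')
    simp only at h
    rw [← h1, h, h2]

/-- Besides the initial segment only the position `2 * p - s` is forced, and its rank condition
splits the choice: `p - s` of the `2 (p - s)` free positions below it and `k - 1 - p` of the `2 (k -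
1 - p)` above. -/
theorem card_balancedSets_Ico_erase {s p : ℕ} (hsp : s ≤ p) (hp : p < k) :
    #(balancedSets k ((Ico s k).erase p)) =
      (p - s).centralBinom * (k - 1 - p).centralBinom := by
  have hKc : #((Ico s k).erase p) = k - s - 1 := by
    rw [card_erase_of_mem (mem_Ico.2 ⟨hsp, hp⟩), Nat.card_Ico]
  have hdp : blockStart ((Ico s k).erase p) p = 2 * p - s := by
    have : {y ∈ (Ico s k).erase p | y < p} = Ico s p := by
      ext y
      simp only [mem_filter, mem_erase, mem_Ico]
      omega
    rw [blockStart, this, Nat.card_Ico]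
    omega
  have hds : ∀ x < s, blockStart ((Ico s k).erase p) x = x := fun x hx =>
    blockStart_of_forall_le fun y hy => by
      have := mem_Ico.1 (mem_of_mem_erase hy)
      omega
  have hcard : #(powersetCard (p - s) (Ico s (2 * p - s)) ×ˢ
      powersetCard (k - 1 - p) (Ico (2 * p - s + 1) (k + (k - s - 1)))) =
      (p - s).centralBinom * (k - 1 - p).centralBinom := by
    rw [card_product, card_powersetCard, card_powersetCard, Nat.card_Ico, Nat.card_Ico,
      Nat.centralBinom, Nat.centralBinom]
    congr 2 <;> omega
  have hiff : ∀ A, A ∈ balancedSets k ((Ico s k).erase p) ↔ A ⊆ range (k + (k - s - 1)) ∧ #A = k ∧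
      range s ⊆ A ∧ 2 * p - s ∈ A ∧ #{y ∈ A | y < 2 * p - s} = p := by
    intro A
    rw [mem_balancedSets, hKc]
    refine and_congr_right fun _ => and_congr_right fun _ => ⟨fun h => ?_, ?_⟩
    · have hp' := h p hp (by simp)
      rw [hdp] at hp'
      refine ⟨fun x hx => ?_, hp'⟩
      have hx := mem_range.1 hx
      have := (h x (by omega) (by simp; omega)).1
      rwa [hds x hx] at this
    · rintro ⟨h1, h2, h3⟩ x hx hxK
      by_cases hxp : x = p
      · subst hxp
        rw [hdp]
        exact ⟨h2, h3⟩
      · have hxs : x < s := by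
          by_contra hcon
          exact hxK (mem_erase.2 ⟨hxp, mem_Ico.2 ⟨by omega, hx⟩⟩)
        rw [hds x hxs]
        refine ⟨h1 (mem_range.2 hxs), ?_⟩
        have : {y ∈ A | y < x} = range x := by
          ext y
          simp only [mem_filter, mem_range]
          exact ⟨fun h => h.2, fun h => ⟨h1 (mem_range.2 (by omega)), h⟩⟩
        rw [this, card_range]
  rw [← hcard]
  refine card_bij' (fun A _ => ({y ∈ A | y ∈ Ico s (2 * p - s)}, {y ∈ A | 2 * p - s < y}))
    (fun q _ => range s ∪ q.1 ∪ {2 * p - s} ∪ q.2) ?_ ?_ ?_ ?_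
  · intro A hA
    obtain ⟨h1, h2, h3, h4, h5⟩ := (hiff A).1 hA
    have e1 : {y ∈ A | y < 2 * p - s} = range s ∪ {y ∈ A | y ∈ Ico s (2 * p - s)} := by
      ext y
      simp only [mem_filter, mem_union, mem_range, mem_Ico]
      constructor
      · rintro ⟨h, h'⟩
        by_cases hy : y < s
        · exact Or.inl hy
        · exact Or.inr ⟨h, by omega, h'⟩
      · rintro (h | h)
        · exact ⟨h3 (mem_range.2 h), by omega⟩
        · exact ⟨h.1, h.2.2⟩
    have e2 : A = {y ∈ A | y < 2 * p - s} ∪ ({2 * p - s} ∪ {y ∈ A | 2 * p - s < y}) := by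
      ext y
      simp only [mem_filter, mem_union, mem_singleton]
      constructor
      · intro h
        rcases lt_trichotomy y (2 * p - s) with h' | h' | h'
        · exact Or.inl ⟨h, h'⟩
        · exact Or.inr (Or.inl h')
        · exact Or.inr (Or.inr ⟨h, h'⟩)
      · rintro (h | rfl | h)
        · exact h.1
        · exact h4
        · exact h.1
    have c1 := congrArg card e1
    rw [h5, card_union_of_disjoint (by
      rw [disjoint_left]
      intro y hy hy'
      have := mem_range.1 hy
      have := mem_Ico.1 (mem_filter.1 hy').2
      omega), card_range] at c1
    have c2 := congrArg card e2
    rw [h2, card_union_of_disjoint (by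
      rw [disjoint_left]
      intro y hy hy'
      simp only [mem_filter, mem_union, mem_singleton] at hy hy'
      omega), card_union_of_disjoint (by simp), h5, card_singleton] at c2
    refine mem_product.2 ⟨mem_powersetCard.2 ⟨fun y hy => (mem_filter.1 hy).2, ?_⟩,
      mem_powersetCard.2 ⟨fun y hy => ?_, ?_⟩⟩
    · simp only
      omega
    · have hy' := mem_filter.1 hy
      have := mem_range.1 (h1 hy'.1)
      exact mem_Ico.2 ⟨hy'.2, this⟩
    · simp only
      omega
  · rintro ⟨S, S'⟩ hq
    obtain ⟨hS, hS'⟩ := mem_product.1 hq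
    obtain ⟨h1, h2⟩ := mem_powersetCard.1 hS
    obtain ⟨h1', h2'⟩ := mem_powersetCard.1 hS'
    simp only at h1 h2 h1' h2'
    have g1 : ∀ y ∈ S, s ≤ y ∧ y < 2 * p - s := fun y hy => mem_Ico.1 (h1 hy)
    have g2 : ∀ y ∈ S', 2 * p - s + 1 ≤ y ∧ y < k + (k - s - 1) := fun y hy => mem_Ico.1 (h1' hy)
    have hd1 : Disjoint (range s) S := by
      rw [disjoint_left]
      intro y hy hy'
      have := mem_range.1 hy
      have := g1 y hy'
      omega
    have hf : {y ∈ range s ∪ S ∪ {2 * p - s} ∪ S' | y < 2 * p - s} = range s ∪ S := by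
      ext y
      simp only [mem_filter, mem_union, mem_range, mem_singleton]
      constructor
      · rintro ⟨((h | h) | h) | h, h'⟩
        · exact Or.inl h
        · exact Or.inr h
        · omega
        · have := g2 y h
          omega
      · rintro (h | h)
        · exact ⟨Or.inl (Or.inl (Or.inl h)), by omega⟩
        · exact ⟨Or.inl (Or.inl (Or.inr h)), (g1 y h).2⟩
    refine (hiff _).2 ⟨?_, ?_, ?_, ?_, ?_⟩
    · intro y hy
      simp only [mem_union, mem_range, mem_singleton] at hy ⊢
      rcases hy with ((h | h) | h) | h
      · omega
      · have := g1 y h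
        omega
      · omega
      · exact (g2 y h).2
    · rw [card_union_of_disjoint, card_union_of_disjoint, card_union_of_disjoint hd1, card_range,
        card_singleton, h2, h2']
      · omega
      · rw [disjoint_left]
        intro y hy hy'
        simp only [mem_union, mem_range, mem_singleton] at hy hy'
        rcases hy with h | h
        · omega
        · have := g1 y h
          omega
      · rw [disjoint_left]
        intro y hy hy'
        have := g2 y hy'
        simp only [mem_union, mem_range, mem_singleton] at hy
        rcases hy with (h | h) | h
        · omega
        · have := g1 y h
          omega
        · omega
    · intro y hy
      simp only [mem_union]
      exact Or.inl (Or.inl (Or.inl hy))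
    · simp
    · rw [hf, card_union_of_disjoint hd1, card_range, h2]
      omega
  · intro A hA
    obtain ⟨h1, h2, h3, h4, h5⟩ := (hiff A).1 hA
    ext y
    simp only [mem_filter, mem_union, mem_range, mem_singleton, mem_Ico]
    constructor
    · rintro (((h | h) | rfl) | h)
      · exact h3 (mem_range.2 h)
      · exact h.1
      · exact h4
      · exact h.1
    · intro h
      by_cases hy : y < s
      · exact Or.inl (Or.inl (Or.inl hy))
      rcases lt_trichotomy y (2 * p - s) with h' | h' | h'
      · exact Or.inl (Or.inl (Or.inr ⟨h, by omega, h'⟩))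
      · exact Or.inl (Or.inr h')
      · exact Or.inr ⟨h, h'⟩
  · rintro ⟨S, S'⟩ hq
    obtain ⟨hS, hS'⟩ := mem_product.1 hq
    have g1 : ∀ y ∈ S, s ≤ y ∧ y < 2 * p - s := fun y hy =>
      mem_Ico.1 ((mem_powersetCard.1 hS).1 hy)
    have g2 : ∀ y ∈ S', 2 * p - s + 1 ≤ y ∧ y < k + (k - s - 1) := fun y hy =>
      mem_Ico.1 ((mem_powersetCard.1 hS').1 hy)
    refine Prod.ext ?_ ?_
    · ext y
      simp only [mem_filter, mem_union, mem_range, mem_singleton, mem_Ico]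
      constructor
      · rintro ⟨((h | h) | h) | h, h'⟩
        · omega
        · exact h
        · omega
        · have := g2 y h
          omega
      · intro h
        exact ⟨Or.inl (Or.inl (Or.inr h)), g1 y h⟩
    · ext y
      simp only [mem_filter, mem_union, mem_range, mem_singleton]
      constructor
      · rintro ⟨((h | h) | h) | h, h'⟩
        · omega
        · have := g1 y h
          omega
        · omega
        · exact h
      · intro h
        exact ⟨Or.inr h, (g2 y h).1⟩

end Counting

/-! ### Strict log-convexity of central binomial coefficients -/

/-- The ratio of consecutive central binomial coefficients is `2 (2p + 1) / (p + 1)`, which is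
strictly increasing in `p`. -/
theorem centralBinom_mul_lt {p q : ℕ} (h : p < q) :
    (p + 1).centralBinom * q.centralBinom < p.centralBinom * (q + 1).centralBinom := by
  have h1 := Nat.succ_mul_centralBinom_succ p
  have h2 := Nat.succ_mul_centralBinom_succ q
  have hp := Nat.centralBinom_pos p
  have hq := Nat.centralBinom_pos q
  have h3 : (p + 1) * (q + 1) * ((p + 1).centralBinom * q.centralBinom) =
      (2 * (2 * p + 1) * (q + 1)) * (p.centralBinom * q.centralBinom) := by
    linear_combination (q + 1) * q.centralBinom * h1
  have h4 : (p + 1) * (q + 1) * (p.centralBinom * (q + 1).centralBinom) =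
      (2 * (2 * q + 1) * (p + 1)) * (p.centralBinom * q.centralBinom) := by
    linear_combination (p + 1) * p.centralBinom * h2
  refine lt_of_mul_lt_mul_left (a := (p + 1) * (q + 1)) ?_ (Nat.zero_le _)
  rw [h3, h4]
  refine Nat.mul_lt_mul_of_pos_right ?_ (Nat.mul_pos hp hq)
  nlinarith

theorem centralBinom_mul_lt_of_lt {p q : ℕ} (d : ℕ) (hd : 0 < d) (h : p + d ≤ q) :
    (p + d).centralBinom * q.centralBinom < p.centralBinom * (q + d).centralBinom := by
  induction d, hd using Nat.le_induction generalizing p q with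
  | base => exact centralBinom_mul_lt h
  | succ d _ ih =>
    have h1 := ih (p := p + 1) (q := q) (by omega)
    have h2 := centralBinom_mul_lt (p := p) (q := q + d) (by omega)
    rw [show p + 1 + d = p + (d + 1) by omega] at h1
    exact h1.trans h2

/-- For a fixed sum the product strictly grows as the pair spreads apart, so it determines the
unordered pair. -/
theorem eq_or_eq_of_centralBinom_mul_eq {p q p' q' : ℕ} (hadd : p + q = p' + q')
    (h : p.centralBinom * q.centralBinom = p'.centralBinom * q'.centralBinom) :
    p = p' ∨ p = q' := by
  have key : ∀ {p q p' q' : ℕ}, p ≤ q → p' ≤ q' → p + q = p' + q' →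
      p.centralBinom * q.centralBinom = p'.centralBinom * q'.centralBinom → p ≤ p' := by
    intro p q p' q' hpq hpq' hadd h
    by_contra hlt
    push Not at hlt
    have := centralBinom_mul_lt_of_lt (p := p') (q := q) (p - p') (by omega) (by omega)
    rw [show p' + (p - p') = p by omega, show q + (p - p') = q' by omega] at this
    omega
  have key2 : ∀ {p q p' q' : ℕ}, p ≤ q → p' ≤ q' → p + q = p' + q' →
      p.centralBinom * q.centralBinom = p'.centralBinom * q'.centralBinom → p = p' :=
    fun h1 h2 h3 h4 => le_antisymm (key h1 h2 h3 h4) (key h2 h1 h3.symm h4.symm)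
  rcases le_total p q with h1 | h1 <;> rcases le_total p' q' with h2 | h2
  · exact Or.inl (key2 h1 h2 hadd h)
  · exact Or.inr (key2 h1 h2 (by omega) (by rw [h, mul_comm]))
  · have := key2 h1 h2 (by omega) (by rw [mul_comm, h])
    omega
  · have := key2 h1 h2 (by omega) (by rw [mul_comm, h, mul_comm])
    omega


/-! ### Comparing two permutations -/

/-- The set of values of `π` from the (0-based) position `j` on. -/
def suffixValues {k : ℕ} (π : Equiv.Perm (Fin k)) (j : ℕ) : Finset ℕ :=
  ({i : Fin k | j ≤ (i : ℕ)} : Finset (Fin k)).image fun i => (π i : ℕ)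

section SuffixValues

variable {k : ℕ} {π π' : Equiv.Perm (Fin k)}

theorem mem_suffixValues {j z : ℕ} :
    z ∈ suffixValues π j ↔ ∃ i : Fin k, j ≤ (i : ℕ) ∧ (π i : ℕ) = z := by
  simp [suffixValues]

theorem apply_mem_suffixValues {j : ℕ} {i : Fin k} :
    (π i : ℕ) ∈ suffixValues π j ↔ j ≤ (i : ℕ) := by
  rw [mem_suffixValues]
  constructor
  · rintro ⟨i', h, hi⟩
    rwa [← π.injective (Fin.ext hi)]
  · exact fun h => ⟨i, h, rfl⟩

theorem suffixValues_subset (j : ℕ) : suffixValues π j ⊆ range k := by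
  intro z hz
  obtain ⟨i, -, rfl⟩ := mem_suffixValues.1 hz
  simp

theorem mem_prefixValues_iff (j : ℕ) (x : Fin k) :
    x ∈ prefixValues π j ↔ (x : ℕ) ∉ suffixValues π j := by
  obtain ⟨i, rfl⟩ := π.surjective x
  rw [apply_mem_suffixValues]
  simp [prefixValues]

theorem card_prefixValues {j : ℕ} (hj : j ≤ k) : #(prefixValues π j) = j := by
  have : prefixValues π j = (univ : Finset (Fin j)).image fun i : Fin j => π ⟨i, by omega⟩ := by
    ext x
    obtain ⟨y, rfl⟩ := π.surjective x
    simp only [prefixValues, mem_filter, mem_univ, true_and, Equiv.symm_apply_apply, mem_image,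
      π.injective.eq_iff]
    exact ⟨fun h => ⟨⟨y, h⟩, rfl⟩, fun ⟨i, hi⟩ => hi ▸ i.2⟩
  rw [this, card_image_of_injective]
  · simp
  · intro a b hab
    simpa [Fin.ext_iff] using hab

theorem card_suffixValues {j : ℕ} (hj : j ≤ k) : #(suffixValues π j) = k - j := by
  have := card_add_card_of_compl (mem_prefixValues_iff (π := π) j) (suffixValues_subset j)
  rw [card_prefixValues hj] at this
  omega

theorem card_gluedPairs_prefixValues {n j : ℕ} (hj : j ≤ k) :
    Nat.card (GluedPairs (prefixValues π j) n) =
      Nat.card (Fin (2 * k - j) ↪o Fin n) * #(balancedSets k (suffixValues π j)) := by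
  rw [card_gluedPairs_eq_mul, card_prefixValues hj]
  rw [card_gluedPairs (mem_prefixValues_iff (π := π) j) (suffixValues_subset j)]
  rw [card_suffixValues hj]
  omega

/-- The factor is independent of `π`; its positivity at `n = 2 * k - j` allows cancelling it. -/
theorem exists_branchSum_eq_mul_card_balancedSets {n j : ℕ} (hj : 1 ≤ j) (hjk : j ≤ k)
    (hn : 2 * k - j ≤ n) : ∃ c, (n = 2 * k - j → 0 < c) ∧ ∀ π : Equiv.Perm (Fin k),
      branchSum π n j = c * #(balancedSets k (suffixValues π j)) := by
  obtain ⟨c, hc, h⟩ := exists_branchSum_eq hj hjk hn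
  refine ⟨c * Nat.card (Fin (2 * k - j) ↪o Fin n), ?_, fun π => ?_⟩
  · rintro rfl
    exact Nat.mul_pos hc (Nat.card_pos_iff.2 ⟨⟨RelEmbedding.refl _⟩, inferInstance⟩)
  · rw [h, card_gluedPairs_prefixValues hjk, mul_assoc]

/-- If the pairs of instances with larger overlap are equally numerous, then so are the pairs
with overlap `j`. -/
theorem branchSum_add_offsetSum_eq {j : ℕ} (hj : 1 ≤ j) (hjk : j ≤ k)
    (hmom : secondMoment π (2 * k - j) = secondMoment π' (2 * k - j))
    (h : ∀ i, j < i → i ≤ k →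
      #(balancedSets k (suffixValues π i)) = #(balancedSets k (suffixValues π' i))) :
    branchSum π (2 * k - j) j + offsetSum π (2 * k - j) =
      branchSum π' (2 * k - j) j + offsetSum π' (2 * k - j) := by
  have hmem : j ∈ range (k + 1) := mem_range.2 (by omega)
  rw [secondMoment_eq_branchSum_add, secondMoment_eq_branchSum_add, ← add_sum_erase _ _ hmem,
    ← add_sum_erase _ _ hmem] at hmom
  have : ∑ i ∈ (range (k + 1)).erase j, branchSum π (2 * k - j) i =
      ∑ i ∈ (range (k + 1)).erase j, branchSum π' (2 * k - j) i := by
    refine sum_congr rfl fun i hi => ?_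
    simp only [mem_erase, mem_range] at hi
    rcases Nat.lt_or_ge i j with hij | hij
    -- A pair sharing only `i < j` vertices needs `2k - i` labels, more than are available.
    · rw [branchSum_eq_zero π (by omega), branchSum_eq_zero π' (by omega)]
    · obtain ⟨c, -, hc⟩ := exists_branchSum_eq_mul_card_balancedSets (k := k) (n := 2 * k - j)
        (j := i) (by omega) (by omega) (by omega)
      rw [hc, hc, h i (by omega) (by omega)]
  omega

theorem StartsWithIdentity.suffixValues_eq {s : ℕ} (h : StartsWithIdentity π s) :
    suffixValues π s = Ico s k := by
  ext z
  rw [mem_Ico]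
  constructor
  · intro hz
    obtain ⟨i, hi, rfl⟩ := mem_suffixValues.1 hz
    exact ⟨h.le_apply hi, (π i).2⟩
  · rintro ⟨h1, h2⟩
    obtain ⟨i, hi⟩ := π.surjective ⟨z, h2⟩
    refine mem_suffixValues.2 ⟨i, ?_, by rw [hi]⟩
    by_contra hlt
    push Not at hlt
    rw [h.2 i hlt] at hi
    rw [hi] at hlt
    simp only at hlt
    omega

theorem suffixValues_succ {s : ℕ} (hs : s < k) :
    suffixValues π (s + 1) = (suffixValues π s).erase (π ⟨s, hs⟩) := by
  ext z
  simp only [mem_erase, mem_suffixValues]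
  constructor
  · rintro ⟨i, hi, rfl⟩
    refine ⟨fun heq => ?_, i, by omega, rfl⟩
    have := congrArg Fin.val (π.injective (Fin.ext heq))
    simp only at this
    omega
  · rintro ⟨hne, i, hi, rfl⟩
    refine ⟨i, ?_, rfl⟩
    have : (i : ℕ) ≠ s := fun heq => hne (by congr 2; exact Fin.ext heq)
    omega

theorem not_suffixHasConsecutive_iff {j : ℕ} (hj : j ≤ k) :
    ¬ SuffixHasConsecutive π (j + 1) ↔
      #(balancedSets k (suffixValues π j)) = 2 ^ (k - j) := by
  have key : SuffixHasConsecutive π (j + 1) ↔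
      ∃ x ∈ suffixValues π j, x + 1 ∈ suffixValues π j := by
    constructor
    · rintro ⟨i, i', hi, hi', h⟩
      exact ⟨π i, apply_mem_suffixValues.2 (by omega),
        h ▸ apply_mem_suffixValues.2 (by omega)⟩
    · rintro ⟨x, hx, hx'⟩
      obtain ⟨i, hi, rfl⟩ := mem_suffixValues.1 hx
      obtain ⟨i', hi', h⟩ := mem_suffixValues.1 hx'
      exact ⟨i, i', by omega, by omega, h⟩
  rw [key, ← card_suffixValues (π := π) hj]
  constructor
  · intro h
    push Not at h
    exact card_balancedSets_eq_two_pow (suffixValues_subset j) h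
  · rintro h ⟨x, hx, hx'⟩
    exact (two_pow_card_lt_card_balancedSets (suffixValues_subset j) hx hx').ne' h

theorem exists_isStreak (π : Equiv.Perm (Fin k)) : ∃ s, IsStreak π s := by
  have hb : BddAbove {m : ℕ | StartsWithIdentity π m} := ⟨k, fun m hm => hm.1⟩
  exact ⟨_, Nat.sSup_mem ⟨0, Nat.zero_le _, fun i hi => absurd hi (Nat.not_lt_zero _)⟩ hb,
    fun m hm => le_csSup hb hm⟩

theorem IsStreak.lt_apply {s : ℕ} (h : IsStreak π s) (hs : s < k) : s < (π ⟨s, hs⟩ : ℕ) := by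
  refine lt_of_le_of_ne (h.1.le_apply le_rfl) fun heq => ?_
  have : StartsWithIdentity π (s + 1) := by
    refine ⟨hs, fun i hi => ?_⟩
    rcases Nat.lt_succ_iff_lt_or_eq.1 hi with hi | hi
    · exact h.1.2 i hi
    · have : i = ⟨s, hs⟩ := Fin.ext hi
      rw [this]
      exact Fin.ext heq.symm
  have := h.2 this
  omega

/-- Downward induction on `j`: above both streaks the offset pairs vanish, and the second moment at
`n = 2k - j` isolates overlap `j`. -/
theorem IsGrounded.card_balancedSets_eq {s s' : ℕ} (hπ : IsGrounded π) (hπ' : IsGrounded π')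
    (hs : IsStreak π s) (hs' : IsStreak π' s')
    (hmom : ∀ n, secondMoment π n = secondMoment π' n) {j : ℕ} (hj : s < j) (hj' : s' < j)
    (hjk : j ≤ k) :
    #(balancedSets k (suffixValues π j)) = #(balancedSets k (suffixValues π' j)) := by
  obtain ⟨h1, h2, h3⟩ := hπ.streak hs
  obtain ⟨h1', h2', h3'⟩ := hπ'.streak hs'
  obtain ⟨m, rfl⟩ : ∃ m, j = k - m := ⟨k - j, by omega⟩
  induction m using Nat.strong_induction_on with
  | _ m ih =>
    have hsum := branchSum_add_offsetSum_eq (π := π) (π' := π') (j := k - m) (by omega) hjk (hmom _)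
      fun i hi hik => by
        have := ih (k - i) (by omega) (by omega) (by omega) (by omega)
        rwa [show k - (k - i) = i by omega] at this
    rw [offsetSum_eq_zero h1 hs.1 h3 (by omega), offsetSum_eq_zero h1' hs'.1 h3' (by omega)] at hsum
    obtain ⟨c, hc, hb⟩ := exists_branchSum_eq_mul_card_balancedSets (k := k)
      (n := 2 * k - (k - m)) (j := k - m) (by omega) hjk le_rfl
    rw [hb, hb] at hsum
    exact Nat.eq_of_mul_eq_mul_left (hc rfl) (by omega)

/-- If `s' < s`, compare at `n = 2k - s`: `π` has offset pairs and `π'` has none, while the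
branching pairs of `π` are already at least as numerous, its suffix values being a final interval.
The totals could not agree. -/
theorem IsGrounded.streak_le {s s' : ℕ} (hπ : IsGrounded π) (hπ' : IsGrounded π')
    (hs : IsStreak π s) (hs' : IsStreak π' s')
    (hmom : ∀ n, secondMoment π n = secondMoment π' n) : s ≤ s' := by
  by_contra hlt
  push Not at hlt
  obtain ⟨h1, h2, h3⟩ := hπ.streak hs
  obtain ⟨h1', h2', h3'⟩ := hπ'.streak hs'
  have hsum := branchSum_add_offsetSum_eq (π := π) (π' := π') (j := s) h1 h2.le (hmom _)
    fun i hi hik => hπ.card_balancedSets_eq hπ' hs hs' hmom hi (by omega) hik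
  rw [offsetSum_eq_zero h1' hs'.1 h3' (by omega)] at hsum
  have hpos := offsetSum_pos h1 h2 hs.1
  obtain ⟨c, -, hb⟩ := exists_branchSum_eq_mul_card_balancedSets (k := k)
    (n := 2 * k - s) (j := s) h1 h2.le le_rfl
  have hle : #(balancedSets k (suffixValues π' s)) ≤ #(balancedSets k (suffixValues π s)) := by
    refine (card_balancedSets_le (suffixValues_subset s)).trans ?_
    rw [card_suffixValues h2.le, hs.1.suffixValues_eq]
    exact centralBinom_le_card_balancedSets_Ico h2.le
  rw [hb, hb] at hsum
  have := Nat.mul_le_mul_left c hle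
  omega

theorem IsGrounded.separationIndex_le {s d d' : ℕ} (hπ : IsGrounded π) (hπ' : IsGrounded π')
    (hs : IsStreak π s) (hs' : IsStreak π' s)
    (hmom : ∀ n, secondMoment π n = secondMoment π' n) (hd : IsSeparationIndex π d)
    (hd' : IsSeparationIndex π' d') : d' ≤ d := by
  obtain ⟨h1, h2, h3⟩ := hπ.streak hs
  obtain ⟨⟨hd0, hdn⟩, hdl⟩ := hd
  have hdk : d ≤ k + 1 := hdl ⟨Nat.succ_pos _, fun ⟨i, _, hi, _⟩ => by omega⟩
  -- Up to the 1-based position `s + 1` the suffix contains the 0-based values `s` and `s + 1`; both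
  -- exist since `π` moves position `s` to a larger value. So `d - 1` exceeds the streak, where the
  -- counts agree.
  have hsd : s + 1 < d := by
    by_contra hle
    push Not at hle
    have hk : s + 1 < k := lt_of_le_of_lt (hs.lt_apply h2) (π _).2
    have hm1 : s ∈ suffixValues π s := by
      rw [hs.1.suffixValues_eq, mem_Ico]
      omega
    have hm2 : s + 1 ∈ suffixValues π s := by
      rw [hs.1.suffixValues_eq, mem_Ico]
      omega
    obtain ⟨i, hi, hi'⟩ := mem_suffixValues.1 hm1
    obtain ⟨j, hj, hj'⟩ := mem_suffixValues.1 hm2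
    exact hdn ⟨i, j, by omega, by omega, by omega⟩
  refine hd'.2 ⟨hd0, ?_⟩
  obtain ⟨e, rfl⟩ : ∃ e, d = e + 1 := ⟨d - 1, by omega⟩
  rw [not_suffixHasConsecutive_iff (by omega)] at hdn ⊢
  rw [← hdn]
  exact (hπ.card_balancedSets_eq hπ' hs hs' hmom (by omega) (by omega) (by omega)).symm

end SuffixValues

end ForestWilf

/-- Positions and values are 0-based in `Fin k`, so `π(s + 1)` is `(π ⟨s, h⟩ : ℕ) + 1`. -/
theorem proposition3 {k : ℕ} (π π' : Equiv.Perm (Fin k)) (s : ℕ)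
    (hπ : ForestWilf.IsGrounded π) (hπ' : ForestWilf.IsGrounded π')
    (hequiv : ForestWilf.StronglyEquiv π π') (hs : ForestWilf.IsStreak π s) :
    (∃ h : s < k,
      π ⟨s, h⟩ = π' ⟨s, h⟩ ∨
        ((π ⟨s, h⟩ : ℕ) + 1) + ((π' ⟨s, h⟩ : ℕ) + 1) = s + k + 1) ∧
    ∀ d d' : ℕ, ForestWilf.IsSeparationIndex π d → ForestWilf.IsSeparationIndex π' d' →
      d = d' := by
  have hmom := hequiv.secondMoment_eq
  obtain ⟨s', hs'⟩ := ForestWilf.exists_isStreak π'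
  obtain rfl : s = s' := le_antisymm (hπ.streak_le hπ' hs hs' hmom)
    (hπ'.streak_le hπ hs' hs fun n => (hmom n).symm)
  refine ⟨?_, fun d d' hd hd' => le_antisymm
    (hπ'.separationIndex_le hπ hs' hs (fun n => (hmom n).symm) hd' hd)
    (hπ.separationIndex_le hπ' hs hs' hmom hd hd')⟩
  have hsk := (hπ.streak hs).2.1
  refine ⟨hsk, ?_⟩
  -- At `j = s + 1` the suffix values are the interval from `s` with the value at position `s`
  -- removed.
  have h := hπ.card_balancedSets_eq hπ' hs hs' hmom (Nat.lt_succ_self s) (Nat.lt_succ_self s) hsk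
  have h1 := hs.lt_apply hsk
  have h1' := hs'.lt_apply hsk
  rw [Nat.succ_eq_add_one, ForestWilf.suffixValues_succ hsk, ForestWilf.suffixValues_succ hsk,
    hs.1.suffixValues_eq, hs'.1.suffixValues_eq,
    ForestWilf.card_balancedSets_Ico_erase h1.le (π _).2,
    ForestWilf.card_balancedSets_Ico_erase h1'.le (π' _).2] at h
  -- Both index pairs `(p - s, k - 1 - p)` sum to `k - 1 - s`; swapping the entries is the
  -- reflection `p ↦ s + k - 1 - p`.
  rcases ForestWilf.eq_or_eq_of_centralBinom_mul_eq (by omega) h with h | h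
  · left
    ext
    omega
  · right
    omega
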